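/- **Setting.** Let $k$ be a field, $\mathcal{G}$ a finite abelian group, $G$ a group, $\pi_0 : G \to \mathrm{Aut}_{\mathrm{Group}}(\mathcal{G})$ a group homomorphism and $\theta \in \mathrm{Aut}_{\mathrm{Group}}(\mathcal{G})$, of order $N$, with $\pi_0(g)\theta = \theta\pi_0(g)$ for all $g \in G$. Suppose that the linear extension $\boldsymbol{\theta}$ of $\theta$ to $B = k[\mathcal{G}]$ is diagonalizable, let $U \le k^\times$ be the group generated by its eigenvalues, and let $U \to \mathbf{U}$, $\lambda \mapsto \boldsymbol{\lambda}$, be an isomorphism onto a subgroup $\mathbf{U} \le \mathrm{Ker}(\pi_0) \cap \mathrm{Z}(G)$. Then $B$ is a left $k[G]$-module by $g \cdot b = \pi_0(g)(b)$ for $g \in G$, $b \in \mathcal{G}$, and a left $k[G]$-comodule by $\rho(b) = \boldsymbol{\lambda} \otimes b$ when $\boldsymbol{\theta}(b) = \lambda b$. Let $A = B \times k[G]$ be the resulting biproduct Hopf algebra (smash product algebra and smash coproduct coalgebra on $B \otimes k[G]$), and let $A' = B \times k[\mathbf{U}]$ be the biproduct obtained by restricting the action to $\mathbf{U}$. Let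 $\pi' : A' \to k[\mathbf{U}]$, $\pi'(b \times h) = \epsilon(b)h$, and let $\mathrm{Aut}_{\mathrm{Hopf}}(A',\pi')$ be the group of Hopf algebra automorphisms $F$ of $A'$ with $\pi' \circ F = \pi'$. For such $F$ let $F_L : B \to B$ be $F_L = \Pi \circ F \circ J$, where $J(b) = b \times 1$ and $\Pi(b \times h) = \epsilon(h)b$. For a finite abelian group $\mathbf{G}$ (written additively), $\sigma \in \mathrm{Aut}_{\mathrm{Group}}(\mathbf{G})$ of order $N$ and a primitive $N$-th root of unity $\lambda \in k^\times$, let $\mathcal{F}_{\mathbf{G},\sigma,\lambda}$ be the set of pairs $(\tau,\alpha)$ with $\tau \in \mathrm{Sym}(\mathbf{G})$ and $\alpha : \mathbf{G} \to k^\times$ a character such that $\tau\sigma = \sigma\tau$, $\alpha \circ \sigma = \alpha$, $\alpha^N = 1$, and $$\tau(s-m) = \tau(s) - \tau(\sigma^{\ell_\alpha(s,m)}(m)) \quad \text{for all } s, m \in \mathbf{G},$$ where $|m|$ is the length of the $\sigma$-orbit of $m$ and $\ell_\alpha(s,m)$ is the integer with $0 \le \ell_\alpha(s,m) < |m|$ and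 $(\alpha(s)/\alpha(m))^{N/|m|} = (\lambda^{N/|m|})^{\ell_\alpha(s,m)}$. The set $\Gamma(\mathbf{G},\lambda,\sigma)$ of all $\tau$ for which some $(\tau,\alpha)$ lies in $\mathcal{F}_{\mathbf{G},\sigma,\lambda}$ is a subgroup of $\mathrm{Sym}(\mathbf{G})$. **Theorem.** The field $k$ contains a primitive $N$-th root of unity. Assume further that $k$ contains a primitive $|\mathcal{G}|$-th root of unity $\omega$. Let $\mathbf{G} = \mathbb{Z}/n_1 \oplus \cdots \oplus \mathbb{Z}/n_t$ with an isomorphism $\mathbf{G} \to \mathcal{G}$, $\mathbf{m} \mapsto g^{(\mathbf{m})}$; put $\omega^{(\mathbf{m})} = \prod_j \omega^{(|\mathcal{G}|/n_j) m_j}$ and $$e_{\mathbf{m}} = \frac{1}{|\mathcal{G}|}\sum_{\mathbf{r} \in \mathbf{G}} \omega^{(\mathbf{m}\mathbf{r})} g^{(\mathbf{r})} \in B,$$ where $\mathbf{m}\mathbf{r}$ is the componentwise product. Then there is a unique $\sigma \in \mathrm{Aut}_{\mathrm{Group}}(\mathbf{G})$ with $\boldsymbol{\theta}(e_{\mathbf{m}})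 = e_{\sigma(\mathbf{m})}$ for all $\mathbf{m} \in \mathbf{G}$; it has order $N$, and for every primitive $N$-th root of unity $\lambda \in k^\times$ (which then lies in $U$) the following hold. (a) There is an isomorphism of groups $\Phi : \mathrm{Aut}_{\mathrm{Hopf}}(A',\pi') \to \Gamma(\mathbf{G},\lambda,\sigma)$ such that $F_L(e_{\mathbf{m}}) = e_{\Phi(F)(\mathbf{m})}$ for all $F$ and all $\mathbf{m} \in \mathbf{G}$. (b) For $F \in \mathrm{Aut}_{\mathrm{Hopf}}(A',\pi')$, the map $F_L$ is a coalgebra map if and only if $\Phi(F) \in \mathrm{Aut}_{\mathrm{Group}}(\mathbf{G})$. (c) There is a bijection $\mathrm{Aut}_{\mathrm{Hopf}}(A',\pi') \to \mathcal{F}_{\mathbf{G},\sigma,\lambda}$, $F \mapsto (\tau,\alpha)$, with $\tau = \Phi(F)$ and $$F(e_{\mathbf{s}} \times \boldsymbol{\lambda}^{\ell}) = \alpha(\mathbf{s})^{\ell}\, e_{\tau(\mathbf{s})} \times \boldsymbol{\lambda}^{\ell} \quad \text{for all } \mathbf{s} \in \mathbf{G},\ \ell \ge 0.$$ -/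

import Mathlib

open scoped TensorProduct

noncomputable section

section Formulas

variable {k B H : Type*} [Field k] [Ring B] [Bialgebra k B] [Ring H] [Bialgebra k H]

/-- The smash product multiplication `(b ⊗ h)(b' ⊗ h') = b (h₍₁₎ · b') ⊗ h₍₂₎ h'`
attached to a left action `act : H ⊗ B → B`. -/
def smashMul (act : H ⊗[k] B →ₗ[k] B) :
    (B ⊗[k] H) ⊗[k] (B ⊗[k] H) →ₗ[k] B ⊗[k] H :=
  (LinearMap.mul' k B).rTensor H ∘ₗ
  (TensorProduct.assoc k B B H).symm.toLinearMap ∘ₗ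
  (TensorProduct.map act (LinearMap.mul' k H) ∘ₗ
    (TensorProduct.tensorTensorTensorComm k H H B H).toLinearMap ∘ₗ
    (Coalgebra.comul (R := k) (A := H)).rTensor (B ⊗[k] H)).lTensor B ∘ₗ
  (TensorProduct.assoc k B H (B ⊗[k] H)).toLinearMap

/-- The smash coproduct
`Δ (b ⊗ h) = (b₍₁₎ ⊗ b₍₂₎₍₋₁₎ h₍₁₎) ⊗ (b₍₂₎₍₀₎ ⊗ h₍₂₎)`
attached to a left coaction `ρ : B → H ⊗ B`. -/
def smashComul (ρ : B →ₗ[k] H ⊗[k] B) :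
    B ⊗[k] H →ₗ[k] (B ⊗[k] H) ⊗[k] (B ⊗[k] H) :=
  ((LinearMap.mul' k H).lTensor B ∘ₗ
    (TensorProduct.assoc k B H H).toLinearMap).rTensor (B ⊗[k] H) ∘ₗ
  (TensorProduct.tensorTensorTensorComm k (B ⊗[k] H) B H H).toLinearMap ∘ₗ
  (TensorProduct.assoc k B H B).symm.toLinearMap.rTensor (H ⊗[k] H) ∘ₗ
  (ρ.lTensor B).rTensor (H ⊗[k] H) ∘ₗ
  TensorProduct.map Coalgebra.comul Coalgebra.comul

/-- The counit `b ⊗ h ↦ ε(b) ε(h)`. -/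
def smashCounit (k B H : Type*) [Field k] [Ring B] [Bialgebra k B] [Ring H] [Bialgebra k H] :
    B ⊗[k] H →ₗ[k] k :=
  LinearMap.mul' k k ∘ₗ TensorProduct.map Coalgebra.counit Coalgebra.counit

end Formulas

section Diagonalizable

variable {k V : Type*} [Field k] [AddCommGroup V] [Module k V]

/-- `T` is diagonalizable: `V` is the sum of the eigenspaces `V_λ`, `λ ∈ k`. -/
def IsDiagonalizable (T : Module.End k V) : Prop := ⨆ μ : k, T.eigenspace μ = ⊤

variable {H : Type*} [AddCommGroup H] [Module k H]

open Classical in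
/-- For a diagonalizable `T` and `c : k → H`, the linear map `V → H ⊗ V` determined by
`v ↦ c λ ⊗ v` for `v ∈ V_λ`. -/
def eigenCoaction (T : Module.End k V) (hT : IsDiagonalizable T) (c : k → H) :
    V →ₗ[k] H ⊗[k] V :=
  (DirectSum.toModule k k (H ⊗[k] V) fun μ : k =>
      (TensorProduct.mk k H V (c μ)) ∘ₗ (T.eigenspace μ).subtype) ∘ₗ
  (LinearEquiv.ofBijective (DirectSum.coeLinearMap fun μ : k => T.eigenspace μ)
    (DirectSum.isInternal_submodule_of_iSupIndep_of_iSup_eq_top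
      T.eigenspaces_iSupIndep hT)).symm.toLinearMap

theorem eigenCoaction_apply (T : Module.End k V) (hT : IsDiagonalizable T) (c : k → H)
    {μ : k} {v : V} (hv : T v = μ • v) : eigenCoaction T hT c v = c μ ⊗ₜ v := by
  classical
  have hv' : v ∈ T.eigenspace μ := Module.End.mem_eigenspace_iff.2 hv
  have h := DirectSum.isInternal_submodule_of_iSupIndep_of_iSup_eq_top
      T.eigenspaces_iSupIndep hT
  have key : (LinearEquiv.ofBijective (DirectSum.coeLinearMap fun μ : k => T.eigenspace μ) h).symm v
      = DirectSum.lof k k (fun μ : k => T.eigenspace μ) μ ⟨v, hv'⟩ :=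
    (LinearEquiv.symm_apply_eq _).2
      (DirectSum.coeLinearMap_lof (fun μ : k => T.eigenspace μ) μ ⟨v, hv'⟩).symm
  simp only [eigenCoaction, LinearMap.comp_apply, LinearEquiv.coe_coe]
  rw [key, DirectSum.toModule_lof]
  rfl

/-- Linear maps out of a sum of eigenspaces are determined on eigenvectors. -/
theorem IsDiagonalizable.ext {W : Type*} [AddCommGroup W] [Module k W] {T : Module.End k V}
    (hT : IsDiagonalizable T) {f g : V →ₗ[k] W}
    (h : ∀ (μ : k) (v : V), v ≠ 0 → T v = μ • v → f v = g v) : f = g := by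
  rw [← LinearMap.eqLocus_eq_top, eq_top_iff, ← hT]
  refine iSup_le fun μ v hv => ?_
  by_cases h0 : v = 0
  · subst h0; simp
  · exact h μ v h0 (Module.End.mem_eigenspace_iff.1 hv)

end Diagonalizable

/-- The linear extension of `θ ∈ Aut(𝒢)` to the group algebra `k[𝒢]`. -/
def linExt (k : Type*) {𝒢 : Type*} [Field k] [Group 𝒢] (θ : MulAut 𝒢) :
    MonoidAlgebra k 𝒢 ≃ₐ[k] MonoidAlgebra k 𝒢 :=
  MonoidAlgebra.domCongr k k θ

/-- The linear extension of `θ` as a `k`-linear endomorphism of `k[𝒢]`. -/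
abbrev linEnd (k : Type*) {𝒢 : Type*} [Field k] [Group 𝒢] (θ : MulAut 𝒢) :
    Module.End k (MonoidAlgebra k 𝒢) := (linExt k θ).toLinearMap

/-- The subgroup of `kˣ` generated by the eigenvalues of the linear extension of `θ`. -/
def eigenvalueGroup (k : Type*) {𝒢 : Type*} [Field k] [Group 𝒢] (θ : MulAut 𝒢) : Subgroup kˣ :=
  Subgroup.closure {u | (linEnd k θ).HasEigenvalue (u : k)}

/-- The data from which the biproducts `k[𝒢] × k[G]` are built. -/
structure BiproductDatum (k 𝒢 G : Type*) [Field k] [Group 𝒢] [Group G] where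
  /-- the action of `G` on `𝒢` by group automorphisms -/
  act : G →* MulAut 𝒢
  /-- the automorphism `θ` of `𝒢` -/
  θ : MulAut 𝒢
  finite_orbit : ∀ x : 𝒢, (MulAction.orbit (Subgroup.zpowers θ) x).Finite
  diagonalizable : IsDiagonalizable (linEnd k θ)
  act_comm : ∀ g : G, act g * θ = θ * act g
  /-- the subgroup `𝐔` of `G` -/
  bU : Subgroup G
  /-- the isomorphism `U ≃ 𝐔` from the group generated by the eigenvalues -/
  bold : eigenvalueGroup k θ ≃* bU
  bU_le_ker : bU ≤ act.ker
  bU_le_center : bU ≤ Subgroup.center G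

namespace BiproductDatum

variable {k 𝒢 G : Type*} [Field k] [Group 𝒢] [Group G] (D : BiproductDatum k 𝒢 G)

/-- The action of `k[G]` on `k[𝒢]`: the linear extension of `g · x = act g x`. -/
def action : MonoidAlgebra k G ⊗[k] MonoidAlgebra k 𝒢 →ₗ[k] MonoidAlgebra k 𝒢 :=
  TensorProduct.lift
    (MonoidAlgebra.lift k (Module.End k (MonoidAlgebra k 𝒢)) G
      { toFun := fun g => linEnd k (D.act g)
        map_one' := by ext; simp [linEnd, linExt]
        map_mul' := fun a b => by ext; simp [linEnd, linExt] }).toLinearMap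

open Classical in
/-- The element `𝛍` of `𝐔`, viewed in `k[G]`, that corresponds to `μ ∈ U` (zero if `μ ∉ U`). -/
def boldElt (μ : k) : MonoidAlgebra k G :=
  if h : ∃ u : eigenvalueGroup k D.θ, ((u : kˣ) : k) = μ then
    MonoidAlgebra.single (D.bold h.choose : G) 1 else 0

/-- The coaction `k[𝒢] → k[G] ⊗ k[𝒢]`, `b ↦ 𝛍 ⊗ b` for `b ∈ k[𝒢]_μ`. -/
def coaction : MonoidAlgebra k 𝒢 →ₗ[k] MonoidAlgebra k G ⊗[k] MonoidAlgebra k 𝒢 :=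
  eigenCoaction (linEnd k D.θ) D.diagonalizable D.boldElt

/-! Facts about the action and the coaction that give the Hopf algebra axioms. -/

theorem linExt_single (θ : MulAut 𝒢) (x : 𝒢) (a : k) :
    linExt k θ (MonoidAlgebra.single x a) = MonoidAlgebra.single (θ x) a := by
  simp [linExt]

theorem linEnd_single (θ : MulAut 𝒢) (x : 𝒢) (a : k) :
    linEnd k θ (MonoidAlgebra.single x a) = MonoidAlgebra.single (θ x) a := by
  simp [linEnd, linExt]

theorem linEnd_mul (θ : MulAut 𝒢) (b c : MonoidAlgebra k 𝒢) :
    linEnd k θ (b * c) = linEnd k θ b * linEnd k θ c := by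
  simp [linEnd]

theorem linEnd_one (θ : MulAut 𝒢) : linEnd k θ (1 : MonoidAlgebra k 𝒢) = 1 := by
  simp [linEnd]

theorem counit_linEnd (θ : MulAut 𝒢) (b : MonoidAlgebra k 𝒢) :
    Coalgebra.counit (R := k) (linEnd k θ b) = Coalgebra.counit (R := k) b := by
  have : (Coalgebra.counit (R := k) (A := MonoidAlgebra k 𝒢)) ∘ₗ linEnd k θ = Coalgebra.counit := by
    ext; simp [linExt_single]
  exact LinearMap.congr_fun this b

theorem comul_linEnd (θ : MulAut 𝒢) (b : MonoidAlgebra k 𝒢) :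
    Coalgebra.comul (R := k) (linEnd k θ b) =
      TensorProduct.map (linEnd k θ) (linEnd k θ) (Coalgebra.comul (R := k) b) := by
  have : (Coalgebra.comul (R := k) (A := MonoidAlgebra k 𝒢)) ∘ₗ linEnd k θ =
      TensorProduct.map (linEnd k θ) (linEnd k θ) ∘ₗ Coalgebra.comul := by
    ext; simp [linExt_single]
  exact LinearMap.congr_fun this b

theorem antipode_linEnd (θ : MulAut 𝒢) (b : MonoidAlgebra k 𝒢) :
    HopfAlgebra.antipode k (linEnd k θ b) = linEnd k θ (HopfAlgebra.antipode k b) := by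
  have : (HopfAlgebra.antipode k (A := MonoidAlgebra k 𝒢)) ∘ₗ linEnd k θ =
      linEnd k θ ∘ₗ HopfAlgebra.antipode k := by
    ext; simp [linExt_single]
  exact LinearMap.congr_fun this b

theorem action_single (g : G) (b : MonoidAlgebra k 𝒢) :
    D.action (MonoidAlgebra.single g 1 ⊗ₜ b) = linEnd k (D.act g) b := by
  simp [action]

theorem linEnd_act_mul (g h : G) (b : MonoidAlgebra k 𝒢) :
    linEnd k (D.act (g * h)) b = linEnd k (D.act g) (linEnd k (D.act h) b) := by
  have : linEnd k (D.act (g * h)) = linEnd k (D.act g) ∘ₗ linEnd k (D.act h) := by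
    ext; simp [linExt_single]
  exact LinearMap.congr_fun this b

theorem linEnd_act_one (b : MonoidAlgebra k 𝒢) : linEnd k (D.act 1) b = b := by
  have : linEnd k (D.act 1) = LinearMap.id := by
    ext; simp [linExt_single]
  exact LinearMap.congr_fun this b

theorem linEnd_act_comm (g : G) (b : MonoidAlgebra k 𝒢) :
    linEnd k D.θ (linEnd k (D.act g) b) = linEnd k (D.act g) (linEnd k D.θ b) := by
  have : linEnd k D.θ ∘ₗ linEnd k (D.act g) = linEnd k (D.act g) ∘ₗ linEnd k D.θ := by
    ext x
    simp only [LinearMap.comp_apply, MonoidAlgebra.lsingle_apply, linEnd_single]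
    have h := DFunLike.congr_fun (D.act_comm g) x
    simp only [MulAut.mul_apply] at h
    rw [h]
  exact LinearMap.congr_fun this b

/-- The group-like element of `k[G]` given by `u ∈ U`. -/
abbrev gl (u : eigenvalueGroup k D.θ) : G := (D.bold u : G)

theorem gl_mul (u v : eigenvalueGroup k D.θ) : D.gl (u * v) = D.gl u * D.gl v := by
  simp [gl]

theorem gl_comm (u : eigenvalueGroup k D.θ) (g : G) : g * D.gl u = D.gl u * g :=
  Subgroup.mem_center_iff.1 (D.bU_le_center (D.bold u).2) g

theorem act_gl (u : eigenvalueGroup k D.θ) : D.act (D.gl u) = 1 :=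
  D.bU_le_ker (D.bold u).2

theorem act_gl_apply (u : eigenvalueGroup k D.θ) (b : MonoidAlgebra k 𝒢) :
    linEnd k (D.act (D.gl u)) b = b := by
  rw [act_gl, ← map_one D.act, linEnd_act_one]

theorem boldElt_coe (u : eigenvalueGroup k D.θ) :
    D.boldElt ((u : kˣ) : k) = MonoidAlgebra.single (D.gl u) 1 := by
  have h : ∃ v : eigenvalueGroup k D.θ, ((v : kˣ) : k) = ((u : kˣ) : k) := ⟨u, rfl⟩
  have h2 : h.choose = u := Subtype.ext (Units.ext h.choose_spec)
  rw [boldElt, dif_pos h, h2]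

/-- `b` is an eigenvector (or zero) for the eigenvalue `u ∈ U`. -/
def IsEig (u : eigenvalueGroup k D.θ) (b : MonoidAlgebra k 𝒢) : Prop :=
  linEnd k D.θ b = ((u : kˣ) : k) • b

variable {D}

theorem IsEig.coaction {u : eigenvalueGroup k D.θ} {b : MonoidAlgebra k 𝒢} (h : D.IsEig u b) :
    D.coaction b = MonoidAlgebra.single (D.gl u) 1 ⊗ₜ b := by
  rw [BiproductDatum.coaction, eigenCoaction_apply _ _ _ h, boldElt_coe]

theorem IsEig.mul {u v : eigenvalueGroup k D.θ} {b c : MonoidAlgebra k 𝒢} (hb : D.IsEig u b)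
    (hc : D.IsEig v c) : D.IsEig (u * v) (b * c) := by
  unfold IsEig at *
  rw [linEnd_mul, hb, hc, smul_mul_smul_comm]
  simp

theorem IsEig.act {u : eigenvalueGroup k D.θ} {b : MonoidAlgebra k 𝒢} (hb : D.IsEig u b)
    (g : G) : D.IsEig u (linEnd k (D.act g) b) := by
  unfold IsEig at *
  rw [linEnd_act_comm, hb, map_smul]

theorem isEig_one : D.IsEig 1 1 := by
  unfold IsEig
  rw [linEnd_one]; simp

variable (D)

theorem exists_eig {μ : k} {b : MonoidAlgebra k 𝒢} (h0 : b ≠ 0)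
    (h : linEnd k D.θ b = μ • b) : ∃ u : eigenvalueGroup k D.θ, ((u : kˣ) : k) = μ := by
  have hμ : μ ≠ 0 := by
    rintro rfl
    rw [zero_smul] at h
    exact h0 ((linExt k D.θ).injective (by simpa using h))
  have hv : (linEnd k D.θ).HasEigenvalue ((Units.mk0 μ hμ : kˣ) : k) :=
    Module.End.hasEigenvalue_of_hasEigenvector
      ⟨Module.End.mem_eigenspace_iff.2 h, h0⟩
  exact ⟨⟨Units.mk0 μ hμ, Subgroup.subset_closure hv⟩, rfl⟩

theorem iSup_eig :
    ⨆ u : eigenvalueGroup k D.θ, (linEnd k D.θ).eigenspace ((u : kˣ) : k) = ⊤ := by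
  rw [eq_top_iff, ← D.diagonalizable]
  refine iSup_le fun μ b hb => ?_
  by_cases h0 : b = 0
  · subst h0; simp
  · obtain ⟨u, rfl⟩ := D.exists_eig h0 (Module.End.mem_eigenspace_iff.1 hb)
    exact Submodule.mem_iSup_of_mem u hb

theorem ext_eig {W : Type*} [AddCommGroup W] [Module k W] {f g : MonoidAlgebra k 𝒢 →ₗ[k] W}
    (h : ∀ u b, D.IsEig u b → f b = g b) : f = g := by
  refine D.diagonalizable.ext fun μ b h0 hb => ?_
  obtain ⟨u, rfl⟩ := D.exists_eig h0 hb
  exact h u b hb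

/-- Every element of `k[𝒢]` is a finite sum of eigenvectors. -/
theorem exists_sum_eig (b : MonoidAlgebra k 𝒢) :
    ∃ (s : Finset (eigenvalueGroup k D.θ)) (f : eigenvalueGroup k D.θ → MonoidAlgebra k 𝒢),
      (∀ u, D.IsEig u (f u)) ∧ b = ∑ u ∈ s, f u := by
  have hb : b ∈ ⨆ u : eigenvalueGroup k D.θ, (linEnd k D.θ).eigenspace ((u : kˣ) : k) := by
    rw [D.iSup_eig]; trivial
  obtain ⟨f, hf, rfl⟩ := (Submodule.mem_iSup_iff_exists_finsupp _ _).1 hb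
  exact ⟨f.support, f, fun u => Module.End.mem_eigenspace_iff.1 (hf u), rfl⟩

theorem coaction_counit (b : MonoidAlgebra k 𝒢) :
    (Coalgebra.counit (R := k)).lTensor _ (D.coaction b) =
      (1 : MonoidAlgebra k G) ⊗ₜ[k] Coalgebra.counit (R := k) b := by
  have : (Coalgebra.counit (R := k)).lTensor (MonoidAlgebra k G) ∘ₗ D.coaction =
      TensorProduct.mk k (MonoidAlgebra k G) k 1 ∘ₗ Coalgebra.counit := by
    refine D.ext_eig fun u b hb => ?_
    have h1 : Coalgebra.counit (R := k) b = ((u : kˣ) : k) * Coalgebra.counit (R := k) b := by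
      conv_lhs => rw [← counit_linEnd D.θ b, hb, map_smul, smul_eq_mul]
    simp only [LinearMap.comp_apply, hb.coaction, LinearMap.lTensor_tmul,
      TensorProduct.mk_apply]
    by_cases h0 : Coalgebra.counit (R := k) b = 0
    · rw [h0]; simp
    · have : u = 1 := by
        apply Subtype.ext; apply Units.ext
        have := mul_right_cancel₀ h0 (show 1 * _ = _ from (one_mul _).trans h1)
        simpa using this.symm
      subst this
      rw [gl, map_one]; rfl
  exact LinearMap.congr_fun this b

theorem isDiagonalizable_map :
    IsDiagonalizable (TensorProduct.map (linEnd k D.θ) (linEnd k D.θ)) := by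
  rw [IsDiagonalizable, eq_top_iff]
  rintro t -
  induction t using TensorProduct.induction_on with
  | zero => simp
  | add a b ha hb => exact add_mem ha hb
  | tmul a b =>
    obtain ⟨s, f, hf, rfl⟩ := D.exists_sum_eig a
    obtain ⟨s', f', hf', rfl⟩ := D.exists_sum_eig b
    rw [TensorProduct.sum_tmul]
    refine sum_mem fun u _ => ?_
    rw [TensorProduct.tmul_sum]
    refine sum_mem fun v _ => ?_
    refine Submodule.mem_iSup_of_mem (((u : kˣ) : k) * ((v : kˣ) : k)) ?_
    rw [Module.End.mem_eigenspace_iff, TensorProduct.map_tmul, hf u, hf' v,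
      TensorProduct.smul_tmul_smul]

/-- The product coaction on `k[𝒢] ⊗ k[𝒢]`. -/
def coaction₂ : MonoidAlgebra k 𝒢 ⊗[k] MonoidAlgebra k 𝒢 →ₗ[k]
    MonoidAlgebra k G ⊗[k] (MonoidAlgebra k 𝒢 ⊗[k] MonoidAlgebra k 𝒢) :=
  (LinearMap.mul' k (MonoidAlgebra k G)).rTensor _ ∘ₗ
    (TensorProduct.tensorTensorTensorComm k _ _ _ _).toLinearMap ∘ₗ
    TensorProduct.map D.coaction D.coaction

variable {D}

theorem coaction₂_tmul {u v : eigenvalueGroup k D.θ} {b c : MonoidAlgebra k 𝒢}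
    (hb : D.IsEig u b) (hc : D.IsEig v c) :
    D.coaction₂ (b ⊗ₜ c) = MonoidAlgebra.single (D.gl u * D.gl v) 1 ⊗ₜ (b ⊗ₜ c) := by
  simp [coaction₂, hb.coaction, hc.coaction]

variable (D)

theorem coaction₂_eq : D.coaction₂ = eigenCoaction
    (TensorProduct.map (linEnd k D.θ) (linEnd k D.θ)) D.isDiagonalizable_map D.boldElt := by
  refine TensorProduct.ext (D.ext_eig fun u b hb => D.ext_eig fun v c hc => ?_)
  change D.coaction₂ (b ⊗ₜ c) = eigenCoaction _ D.isDiagonalizable_map D.boldElt (b ⊗ₜ c)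
  rw [coaction₂_tmul hb hc, eigenCoaction_apply (μ := ((u : kˣ) : k) * ((v : kˣ) : k))]
  · rw [← gl_mul, ← boldElt_coe]; simp
  · rw [TensorProduct.map_tmul, hb, hc, TensorProduct.smul_tmul_smul]

/-- `k[𝒢]` is a comodule coalgebra. -/
theorem coaction₂_comul (b : MonoidAlgebra k 𝒢) :
    D.coaction₂ (Coalgebra.comul (R := k) b) =
      (Coalgebra.comul (R := k)).lTensor _ (D.coaction b) := by
  have : D.coaction₂ ∘ₗ Coalgebra.comul =
      (Coalgebra.comul (R := k)).lTensor _ ∘ₗ D.coaction := by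
    refine D.ext_eig fun u b hb => ?_
    simp only [LinearMap.comp_apply]
    rw [coaction₂_eq, hb.coaction, eigenCoaction_apply (μ := ((u : kˣ) : k)), boldElt_coe,
      LinearMap.lTensor_tmul]
    rw [← comul_linEnd, hb, map_smul]
  exact LinearMap.congr_fun this b

/-- The underlying vector space `k[𝒢] ⊗ k[G]` of the biproduct `A = k[𝒢] × k[G]`. -/
def Biproduct (_D : BiproductDatum k 𝒢 G) : Type _ :=
  MonoidAlgebra k 𝒢 ⊗[k] MonoidAlgebra k G

instance : AddCommGroup D.Biproduct :=
  inferInstanceAs (AddCommGroup (MonoidAlgebra k 𝒢 ⊗[k] MonoidAlgebra k G))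

instance : Module k D.Biproduct :=
  inferInstanceAs (Module k (MonoidAlgebra k 𝒢 ⊗[k] MonoidAlgebra k G))

/-- The identification of `k[𝒢] ⊗ k[G]` with the biproduct; `b × h` is `D.of (b ⊗ₜ h)`. -/
def of : (MonoidAlgebra k 𝒢 ⊗[k] MonoidAlgebra k G) ≃ₗ[k] D.Biproduct :=
  LinearEquiv.refl k _

/-- Multiplication of the biproduct: the smash product. -/
instance : Mul D.Biproduct :=
  ⟨fun a b => D.of (smashMul D.action (D.of.symm a ⊗ₜ D.of.symm b))⟩

instance : One D.Biproduct := ⟨D.of (1 ⊗ₜ 1)⟩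

/-- Comultiplication and counit of the biproduct: the smash coproduct. -/
instance : CoalgebraStruct k D.Biproduct where
  comul := TensorProduct.map D.of.toLinearMap D.of.toLinearMap ∘ₗ
    smashComul D.coaction ∘ₗ D.of.symm.toLinearMap
  counit := smashCounit k _ _ ∘ₗ D.of.symm.toLinearMap

theorem mul_def (a b : D.Biproduct) :
    a * b = D.of (smashMul D.action (D.of.symm a ⊗ₜ D.of.symm b)) := rfl

theorem counit_of (t : MonoidAlgebra k 𝒢 ⊗[k] MonoidAlgebra k G) :
    Coalgebra.counit (R := k) (D.of t) = smashCounit k _ _ t := rfl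

theorem comul_of (t : MonoidAlgebra k 𝒢 ⊗[k] MonoidAlgebra k G) :
    Coalgebra.comul (R := k) (D.of t) =
      TensorProduct.map D.of.toLinearMap D.of.toLinearMap (smashComul D.coaction t) := rfl

/-- `b × g` for `b ∈ k[𝒢]` and `g ∈ G`. -/
abbrev el (b : MonoidAlgebra k 𝒢) (g : G) : D.Biproduct :=
  D.of (b ⊗ₜ MonoidAlgebra.single g 1)

theorem el_mul_el (b c : MonoidAlgebra k 𝒢) (g h : G) :
    D.el b g * D.el c h = D.el (b * linEnd k (D.act g) c) (g * h) := by
  simp [mul_def, smashMul, action_single]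

theorem one_eq : (1 : D.Biproduct) = D.el 1 1 := rfl

theorem counit_el (b : MonoidAlgebra k 𝒢) (g : G) :
    Coalgebra.counit (R := k) (D.el b g) = Coalgebra.counit (R := k) b := by
  rw [el, counit_of]
  simp [smashCounit]

theorem induction_el {p : D.Biproduct → Prop} (a : D.Biproduct) (h0 : p 0)
    (hadd : ∀ a b, p a → p b → p (a + b)) (hsmul : ∀ (r : k) a, p a → p (r • a))
    (hel : ∀ (x : 𝒢) g, p (D.el (MonoidAlgebra.single x 1) g)) : p a := by
  obtain ⟨t, rfl⟩ := D.of.surjective a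
  induction t using TensorProduct.induction_on with
  | zero => simpa using h0
  | add a b ha hb => rw [map_add]; exact hadd _ _ ha hb
  | tmul b h =>
    induction h using MonoidAlgebra.induction_linear with
    | zero => simpa using h0
    | add f g hf hg => rw [TensorProduct.tmul_add, map_add]; exact hadd _ _ hf hg
    | single g r =>
      induction b using MonoidAlgebra.induction_linear with
      | zero => simpa using h0
      | add f g hf hg => rw [TensorProduct.add_tmul, map_add]; exact hadd _ _ hf hg
      | single x r' =>
        have : D.of (MonoidAlgebra.single x r' ⊗ₜ MonoidAlgebra.single g r) =
            r' • r • D.el (MonoidAlgebra.single x 1) g := by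
          rw [el, ← map_smul, ← map_smul, ← TensorProduct.tmul_smul, TensorProduct.smul_tmul']
          simp
        rw [this]
        exact hsmul _ _ (hsmul _ _ (hel x g))

theorem mul_add' (a b c : D.Biproduct) : a * (b + c) = a * b + a * c := by
  simp [mul_def, TensorProduct.tmul_add]

theorem add_mul' (a b c : D.Biproduct) : (a + b) * c = a * c + b * c := by
  simp [mul_def, TensorProduct.add_tmul]

theorem smul_mul' (r : k) (a b : D.Biproduct) : (r • a) * b = r • (a * b) := by
  rw [mul_def, mul_def, map_smul, ← TensorProduct.smul_tmul', map_smul, map_smul]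

theorem mul_smul' (r : k) (a b : D.Biproduct) : a * (r • b) = r • (a * b) := by
  rw [mul_def, mul_def, map_smul, TensorProduct.tmul_smul, map_smul, map_smul]

theorem zero_mul' (a : D.Biproduct) : 0 * a = 0 := by
  simpa using D.smul_mul' 0 0 a

theorem mul_zero' (a : D.Biproduct) : a * 0 = 0 := by
  simpa using D.mul_smul' 0 a 0

theorem one_mul' (a : D.Biproduct) : 1 * a = a := by
  induction a using D.induction_el with
  | h0 => exact D.mul_zero' 1
  | hadd a b ha hb => rw [mul_add', ha, hb]
  | hsmul r a ha => rw [mul_smul', ha]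
  | hel x g => rw [one_eq, el_mul_el, linEnd_act_one, one_mul, one_mul]

theorem mul_one' (a : D.Biproduct) : a * 1 = a := by
  induction a using D.induction_el with
  | h0 => exact D.zero_mul' 1
  | hadd a b ha hb => rw [add_mul', ha, hb]
  | hsmul r a ha => rw [smul_mul', ha]
  | hel x g => rw [one_eq, el_mul_el, linEnd_one, mul_one, mul_one]

theorem mul_assoc' (a b c : D.Biproduct) : a * b * c = a * (b * c) := by
  induction a using D.induction_el with
  | h0 => simp only [zero_mul']
  | hadd a b ha hb => simp only [add_mul', ha, hb]
  | hsmul r a ha => simp only [smul_mul', ha]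
  | hel x g =>
  induction b using D.induction_el with
  | h0 => simp only [zero_mul', mul_zero']
  | hadd a b ha hb => simp only [add_mul', mul_add', ha, hb]
  | hsmul r a ha => simp only [smul_mul', mul_smul', ha]
  | hel y h =>
  induction c using D.induction_el with
  | h0 => simp only [mul_zero']
  | hadd a b ha hb => simp only [mul_add', ha, hb]
  | hsmul r a ha => simp only [mul_smul', ha]
  | hel z l =>
    simp only [el_mul_el, linEnd_mul, linEnd_act_mul, mul_assoc]

/-- The smash product algebra `k[𝒢] # k[G]`. -/
instance : Ring D.Biproduct where
  __ := (inferInstance : AddCommGroup D.Biproduct)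
  left_distrib := D.mul_add'
  right_distrib := D.add_mul'
  zero_mul := D.zero_mul'
  mul_zero := D.mul_zero'
  mul_assoc := D.mul_assoc'
  one_mul := D.one_mul'
  mul_one := D.mul_one'

instance : Algebra k D.Biproduct := Algebra.ofModule D.smul_mul' D.mul_smul'

/-- The linear map `b ⊗ c ↦ (b × c₍₋₁₎ g) ⊗ (c₍₀₎ × g)`. -/
def split (g : G) : MonoidAlgebra k 𝒢 ⊗[k] MonoidAlgebra k 𝒢 →ₗ[k]
    D.Biproduct ⊗[k] D.Biproduct :=
  TensorProduct.map D.of.toLinearMap (D.of.toLinearMap ∘ₗ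
      (TensorProduct.mk k _ _).flip (MonoidAlgebra.single g 1)) ∘ₗ
    (TensorProduct.assoc k _ _ _).symm.toLinearMap ∘ₗ
    (((LinearMap.mulRight k (MonoidAlgebra.single g (1 : k))).rTensor _ ∘ₗ
      D.coaction).lTensor _)

variable {D} in
theorem split_tmul {u : eigenvalueGroup k D.θ} {c : MonoidAlgebra k 𝒢} (hc : D.IsEig u c)
    (b : MonoidAlgebra k 𝒢) (g : G) :
    D.split g (b ⊗ₜ c) = D.el b (D.gl u * g) ⊗ₜ D.el c g := by
  simp [split, hc.coaction]

theorem comul_el (b : MonoidAlgebra k 𝒢) (g : G) :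
    Coalgebra.comul (R := k) (D.el b g) = D.split g (Coalgebra.comul (R := k) b) := by
  rw [el, comul_of]
  simp only [smashComul, LinearMap.comp_apply, TensorProduct.map_tmul,
    MonoidAlgebra.comul_single]
  generalize Coalgebra.comul (R := k) b = t
  induction t using TensorProduct.induction_on with
  | zero => simp
  | add a b ha hb => simp only [TensorProduct.add_tmul, map_add, ha, hb]
  | tmul b c =>
    obtain ⟨s, f, hf, rfl⟩ := D.exists_sum_eig c
    simp only [TensorProduct.tmul_sum, TensorProduct.sum_tmul, map_sum]
    refine Finset.sum_congr rfl fun u _ => ?_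
    rw [split_tmul (hf u)]
    simp [(hf u).coaction]

/-- Linear maps out of the biproduct are determined on the elements `x × g`. -/
theorem ext_el {W : Type*} [AddCommGroup W] [Module k W] {f f' : D.Biproduct →ₗ[k] W}
    (h : ∀ (x : 𝒢) g, f (D.el (MonoidAlgebra.single x 1) g) =
      f' (D.el (MonoidAlgebra.single x 1) g)) : f = f' := by
  ext a
  induction a using D.induction_el with
  | h0 => simp
  | hadd a b ha hb => rw [map_add, map_add, ha, hb]
  | hsmul r a ha => rw [map_smul, map_smul, ha]
  | hel x g => exact h x g

theorem sum_eig_comul {x : 𝒢} {s : Finset (eigenvalueGroup k D.θ)}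
    {f : eigenvalueGroup k D.θ → MonoidAlgebra k 𝒢} (hf : ∀ u, D.IsEig u (f u))
    (hx : MonoidAlgebra.single x (1 : k) = ∑ u ∈ s, f u) :
    ∑ u ∈ s, MonoidAlgebra.single (D.gl u) (1 : k) ⊗ₜ[k] Coalgebra.comul (R := k) (f u) =
      ∑ u ∈ s, ∑ v ∈ s, MonoidAlgebra.single (D.gl u * D.gl v) (1 : k) ⊗ₜ[k] (f u ⊗ₜ[k] f v) := by
  have h := D.coaction₂_comul (MonoidAlgebra.single x 1)
  have h1 : Coalgebra.comul (R := k) (MonoidAlgebra.single x (1 : k)) =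
      MonoidAlgebra.single x (1 : k) ⊗ₜ[k] MonoidAlgebra.single x (1 : k) := by simp
  rw [h1, hx] at h
  simp only [map_sum, TensorProduct.sum_tmul, TensorProduct.tmul_sum] at h
  rw [Finset.sum_comm] at h
  simp only [coaction₂_tmul (hf _) (hf _), (hf _).coaction, LinearMap.lTensor_tmul] at h
  exact h.symm

theorem sum_eig_counit {x : 𝒢} {s : Finset (eigenvalueGroup k D.θ)}
    {f : eigenvalueGroup k D.θ → MonoidAlgebra k 𝒢} (hf : ∀ u, D.IsEig u (f u))
    (hx : MonoidAlgebra.single x (1 : k) = ∑ u ∈ s, f u) :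
    ∑ u ∈ s, Coalgebra.counit (R := k) (f u) • MonoidAlgebra.single (D.gl u) (1 : k) = 1 := by
  have h := D.coaction_counit (MonoidAlgebra.single x 1)
  have h1 : Coalgebra.counit (R := k) (MonoidAlgebra.single x (1 : k)) = 1 := by simp
  rw [h1, hx] at h
  simp only [map_sum, (hf _).coaction, LinearMap.lTensor_tmul] at h
  simpa using congrArg (TensorProduct.rid k _) h

theorem comul_el_sum {x : 𝒢} {s : Finset (eigenvalueGroup k D.θ)}
    {f : eigenvalueGroup k D.θ → MonoidAlgebra k 𝒢} (hf : ∀ u, D.IsEig u (f u))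
    (hx : MonoidAlgebra.single x (1 : k) = ∑ u ∈ s, f u) (g : G) :
    Coalgebra.comul (R := k) (D.el (MonoidAlgebra.single x 1) g) =
      ∑ u ∈ s, D.el (MonoidAlgebra.single x 1) (D.gl u * g) ⊗ₜ[k] D.el (f u) g := by
  have h1 : Coalgebra.comul (R := k) (MonoidAlgebra.single x (1 : k)) =
      MonoidAlgebra.single x (1 : k) ⊗ₜ[k] MonoidAlgebra.single x (1 : k) := by simp
  rw [comul_el, h1]
  conv_lhs => rw [hx]
  rw [TensorProduct.tmul_sum, map_sum]
  simp only [split_tmul (hf _), ← hx]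

theorem sum_el {x : 𝒢} {s : Finset (eigenvalueGroup k D.θ)}
    {f : eigenvalueGroup k D.θ → MonoidAlgebra k 𝒢}
    (hx : MonoidAlgebra.single x (1 : k) = ∑ u ∈ s, f u) (g : G) :
    ∑ u ∈ s, D.el (f u) g = D.el (MonoidAlgebra.single x 1) g := by
  simp only [el]
  rw [← map_sum, ← TensorProduct.sum_tmul, ← hx]

/-- The smash coproduct coalgebra. -/
instance : Coalgebra k D.Biproduct where
  coassoc := by
    refine D.ext_el fun x g => ?_
    obtain ⟨s, f, hf, hx⟩ := D.exists_sum_eig (MonoidAlgebra.single x 1)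
    simp only [LinearMap.comp_apply]
    rw [D.comul_el_sum hf hx]
    simp only [map_sum, LinearMap.rTensor_tmul, LinearMap.lTensor_tmul, D.comul_el_sum hf hx,
      TensorProduct.sum_tmul]
    have h := congrArg (TensorProduct.map (D.of.toLinearMap ∘ₗ
        TensorProduct.mk k _ _ (MonoidAlgebra.single x (1 : k)) ∘ₗ
        LinearMap.mulRight k (MonoidAlgebra.single g (1 : k))) (D.split g)) (D.sum_eig_comul hf hx)
    simp only [map_sum, TensorProduct.map_tmul, ← comul_el, split_tmul (hf _),
      LinearMap.comp_apply, LinearMap.mulRight_apply, MonoidAlgebra.single_mul_single, mul_one,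
      TensorProduct.mk_apply, LinearEquiv.coe_coe] at h
    refine Eq.trans ?_ h.symm
    rw [Finset.sum_comm]
    simp [mul_assoc]
  rTensor_counit_comp_comul := by
    refine D.ext_el fun x g => ?_
    obtain ⟨s, f, hf, hx⟩ := D.exists_sum_eig (MonoidAlgebra.single x 1)
    simp only [LinearMap.comp_apply]
    rw [D.comul_el_sum hf hx, map_sum]
    simp only [LinearMap.rTensor_tmul, counit_el]
    rw [← TensorProduct.tmul_sum, D.sum_el hx]
    simp
  lTensor_counit_comp_comul := by
    refine D.ext_el fun x g => ?_
    obtain ⟨s, f, hf, hx⟩ := D.exists_sum_eig (MonoidAlgebra.single x 1)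
    simp only [LinearMap.comp_apply]
    rw [D.comul_el_sum hf hx, map_sum]
    simp only [LinearMap.lTensor_tmul, counit_el]
    have h := congrArg (D.of.toLinearMap ∘ₗ
        TensorProduct.mk k _ _ (MonoidAlgebra.single x (1 : k)) ∘ₗ
        LinearMap.mulRight k (MonoidAlgebra.single g (1 : k))) (D.sum_eig_counit hf hx)
    simp only [map_sum, map_smul, LinearMap.comp_apply, LinearMap.mulRight_apply,
      MonoidAlgebra.single_mul_single, mul_one, one_mul,
      TensorProduct.mk_apply, LinearEquiv.coe_coe] at h
    simp only [LinearMap.flip_apply, TensorProduct.mk_apply]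
    simp only [el]
    rw [← h, TensorProduct.sum_tmul]
    refine Finset.sum_congr rfl fun u _ => ?_
    rw [TensorProduct.smul_tmul, smul_eq_mul, mul_one]

theorem counit_mul' (a b : D.Biproduct) :
    Coalgebra.counit (R := k) (a * b) =
      Coalgebra.counit (R := k) a * Coalgebra.counit (R := k) b := by
  induction a using D.induction_el with
  | h0 => simp
  | hadd a b ha hb => simp only [add_mul, map_add, ha, hb]
  | hsmul r a ha => simp only [smul_mul_assoc, map_smul, ha, smul_eq_mul, mul_assoc]
  | hel x g =>
  induction b using D.induction_el with
  | h0 => simp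
  | hadd a b ha hb => simp only [mul_add, map_add, ha, hb]
  | hsmul r a ha =>
    simp only [mul_smul_comm, map_smul, ha, smul_eq_mul]; ring
  | hel y h =>
    rw [el_mul_el, counit_el, counit_el, counit_el, Bialgebra.counit_mul, counit_linEnd]

theorem comul_mul' (a b : D.Biproduct) :
    Coalgebra.comul (R := k) (a * b) =
      Coalgebra.comul (R := k) a * Coalgebra.comul (R := k) b := by
  induction a using D.induction_el with
  | h0 => simp
  | hadd a b ha hb => simp only [add_mul, map_add, ha, hb]
  | hsmul r a ha => simp only [smul_mul_assoc, map_smul, ha]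
  | hel x g =>
  induction b using D.induction_el with
  | h0 => simp
  | hadd a b ha hb => simp only [mul_add, map_add, ha, hb]
  | hsmul r a ha => simp only [mul_smul_comm, map_smul, ha]
  | hel y h =>
    obtain ⟨s, f, hf, hx⟩ := D.exists_sum_eig (MonoidAlgebra.single x 1)
    obtain ⟨s', f', hf', hy⟩ := D.exists_sum_eig (MonoidAlgebra.single y 1)
    have h1 : MonoidAlgebra.single x (1 : k) * linEnd k (D.act g) (MonoidAlgebra.single y 1) =
        MonoidAlgebra.single (x * D.act g y) 1 := by simp [linExt_single]
    have h2 : Coalgebra.comul (R := k) (MonoidAlgebra.single (x * D.act g y) (1 : k)) =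
      MonoidAlgebra.single (x * D.act g y) (1 : k) ⊗ₜ[k]
        ∑ u ∈ s, ∑ v ∈ s', f u * linEnd k (D.act g) (f' v) := by
      rw [← Finset.sum_mul_sum, ← map_sum, ← hx, ← hy, h1]; simp
    rw [el_mul_el, comul_el, h1, h2, D.comul_el_sum hf hx, D.comul_el_sum hf' hy,
      Finset.sum_mul_sum]
    simp only [TensorProduct.tmul_sum, map_sum]
    refine Finset.sum_congr rfl fun u _ => Finset.sum_congr rfl fun v _ => ?_
    rw [split_tmul ((hf u).mul ((hf' v).act g)), Algebra.TensorProduct.tmul_mul_tmul, el_mul_el,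
      el_mul_el, map_mul D.act, act_gl, one_mul, h1, gl_mul]
    congr 2
    rw [mul_assoc, mul_assoc, ← mul_assoc g, gl_comm, mul_assoc]

theorem comul_one' : Coalgebra.comul (R := k) (1 : D.Biproduct) = 1 := by
  rw [one_eq, comul_el, Bialgebra.comul_one, Algebra.TensorProduct.one_def,
    split_tmul isEig_one]
  simp [gl, Algebra.TensorProduct.one_def, one_eq]

instance : Bialgebra k D.Biproduct :=
  Bialgebra.mk' k D.Biproduct (by rw [one_eq, counit_el]; simp) (D.counit_mul' _ _)
    D.comul_one' (D.comul_mul' _ _)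

/-- The antipode `S (b × h) = (1 × S (b₍₋₁₎ h)) (S (b₍₀₎) × 1)`. -/
def antipodeMap : D.Biproduct →ₗ[k] D.Biproduct :=
  LinearMap.mul' k D.Biproduct ∘ₗ
  TensorProduct.map
    (D.of.toLinearMap ∘ₗ TensorProduct.mk k _ _ (1 : MonoidAlgebra k 𝒢) ∘ₗ
      HopfAlgebra.antipode k ∘ₗ LinearMap.mul' k (MonoidAlgebra k G))
    (D.of.toLinearMap ∘ₗ (TensorProduct.mk k _ _).flip (1 : MonoidAlgebra k G) ∘ₗ
      HopfAlgebra.antipode k) ∘ₗ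
  (TensorProduct.assoc k _ _ _).symm.toLinearMap ∘ₗ
  (TensorProduct.comm k _ _).toLinearMap.lTensor (MonoidAlgebra k G) ∘ₗ
  (TensorProduct.assoc k _ _ _).toLinearMap ∘ₗ
  D.coaction.rTensor (MonoidAlgebra k G) ∘ₗ
  D.of.symm.toLinearMap

variable {D} in
theorem antipodeMap_el {u : eigenvalueGroup k D.θ} {b : MonoidAlgebra k 𝒢} (hb : D.IsEig u b)
    (g : G) : D.antipodeMap (D.el b g) =
      D.el (linEnd k (D.act g⁻¹) (HopfAlgebra.antipode k b)) (g⁻¹ * (D.gl u)⁻¹) := by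
  have h1 : ∀ b : MonoidAlgebra k 𝒢, linEnd k (D.act (D.gl u)⁻¹) b = b := fun b => by
    rw [map_inv, act_gl, inv_one, ← map_one D.act, linEnd_act_one]
  have h2 : D.antipodeMap (D.el b g) =
      D.el 1 (D.gl u * g)⁻¹ * D.el (HopfAlgebra.antipode k b) 1 := by
    simp [antipodeMap, hb.coaction, el, MonoidAlgebra.one_def]
  rw [h2, el_mul_el, one_mul, mul_one, mul_inv_rev, linEnd_act_mul, h1]

/-- The biproduct `A = k[𝒢] × k[G]` is a Hopf algebra. -/
instance : HopfAlgebra k D.Biproduct where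
  antipode := D.antipodeMap
  mul_antipode_rTensor_comul := by
    refine D.ext_el fun x g => ?_
    obtain ⟨s, f, hf, hx⟩ := D.exists_sum_eig (MonoidAlgebra.single x 1)
    simp only [LinearMap.comp_apply]
    rw [D.comul_el_sum hf hx, counit_el]
    have h := congrArg (D.of.toLinearMap ∘ₗ (TensorProduct.comm k _ _).toLinearMap ∘ₗ
      TensorProduct.map (HopfAlgebra.antipode k)
        (linEnd k (D.act g⁻¹) ∘ₗ LinearMap.mul' k _ ∘ₗ
          (HopfAlgebra.antipode k).rTensor (MonoidAlgebra k 𝒢))) (D.sum_eig_comul hf hx)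
    simp only [map_sum, LinearMap.comp_apply, TensorProduct.map_tmul, LinearMap.rTensor_tmul,
      LinearMap.mul'_apply, HopfAlgebra.mul_antipode_rTensor_comul_apply,
      LinearEquiv.coe_coe, TensorProduct.comm_tmul, MonoidAlgebra.antipode_single, CommSemiring.antipode_eq_id, LinearMap.id_apply] at h
    have h' := congrArg (D.of.toLinearMap ∘ₗ TensorProduct.mk k _ _ (1 : MonoidAlgebra k 𝒢) ∘ₗ
      HopfAlgebra.antipode k) (D.sum_eig_counit hf hx)
    simp only [map_sum, map_smul, LinearMap.comp_apply, TensorProduct.mk_apply,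
      LinearEquiv.coe_coe, MonoidAlgebra.antipode_single, HopfAlgebra.antipode_one, CommSemiring.antipode_eq_id, LinearMap.id_apply] at h'
    have hc : ∀ u v : eigenvalueGroup k D.θ,
        (D.gl v * g)⁻¹ * (D.gl u)⁻¹ * g = (D.gl u * D.gl v)⁻¹ := fun u v => by
      have := D.gl_comm (u * v) g
      rw [gl_mul] at this
      rw [← mul_inv_rev, ← mul_assoc, ← this, mul_inv_rev, inv_mul_cancel_right]
    have ha : ∀ (u v : eigenvalueGroup k D.θ) (b : MonoidAlgebra k 𝒢),
        linEnd k (D.act ((D.gl v * g)⁻¹ * (D.gl u)⁻¹)) b = linEnd k (D.act g⁻¹) b := fun u v b => by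
      congr 2
      rw [← mul_inv_rev, map_inv, map_mul, map_mul, act_gl, act_gl, one_mul, one_mul, map_inv]
    have ha' : ∀ (v : eigenvalueGroup k D.θ) (b : MonoidAlgebra k 𝒢),
        linEnd k (D.act (D.gl v * g)⁻¹) b = linEnd k (D.act g⁻¹) b := fun v b => by
      congr 2
      rw [map_inv, map_mul, act_gl, one_mul, map_inv]
    have hs : ∀ v : eigenvalueGroup k D.θ,
        D.antipodeMap (D.el (MonoidAlgebra.single x 1) (D.gl v * g)) * D.el (f v) g =
          ∑ u ∈ s, D.el (linEnd k (D.act g⁻¹) (HopfAlgebra.antipode k (f u) * f v))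
            (D.gl u * D.gl v)⁻¹ := fun v => by
      rw [← D.sum_el hx, map_sum, Finset.sum_mul]
      refine Finset.sum_congr rfl fun u _ => ?_
      rw [antipodeMap_el (hf u), el_mul_el, hc, ha, ha', ← linEnd_mul]
    simp only [map_sum, LinearMap.rTensor_tmul, LinearMap.mul'_apply, hs]
    rw [Finset.sum_comm]
    refine h.symm.trans ?_
    have hk : Coalgebra.counit (R := k) (MonoidAlgebra.single x (1 : k)) = 1 := by simp
    rw [hk, Algebra.linearMap_apply, (algebraMap k D.Biproduct).map_one, one_eq, el]
    refine Eq.trans ?_ h'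
    refine Finset.sum_congr rfl fun u _ => ?_
    have hl : linEnd k (D.act g⁻¹) (algebraMap k _ (Coalgebra.counit (R := k) (f u))) =
        Coalgebra.counit (R := k) (f u) • 1 := by
      rw [Algebra.algebraMap_eq_smul_one, map_smul, linEnd_one]
    rw [← map_smul, TensorProduct.smul_tmul', ← hl]
    rfl
  mul_antipode_lTensor_comul := by
    refine D.ext_el fun x g => ?_
    obtain ⟨s, f, hf, hx⟩ := D.exists_sum_eig (MonoidAlgebra.single x 1)
    simp only [LinearMap.comp_apply]
    rw [D.comul_el_sum hf hx, counit_el]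
    have h1 : ∀ (u : eigenvalueGroup k D.θ) (b : MonoidAlgebra k 𝒢),
        linEnd k (D.act (D.gl u * g)) (linEnd k (D.act g⁻¹) b) = b := fun u b => by
      rw [← linEnd_act_mul, mul_inv_cancel_right, act_gl_apply]
    simp only [map_sum, LinearMap.lTensor_tmul, LinearMap.mul'_apply, antipodeMap_el (hf _),
      el_mul_el, h1]
    have h2 : ∀ u : eigenvalueGroup k D.θ, D.gl u * g * (g⁻¹ * (D.gl u)⁻¹) = 1 := fun u => by
      group
    simp only [h2, el]
    rw [← map_sum, ← TensorProduct.sum_tmul, ← Finset.mul_sum, ← map_sum, ← hx]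
    simp [Algebra.algebraMap_eq_smul_one, one_eq, MonoidAlgebra.one_def]

/-- The projection `π : A → k[G]`, `b × h ↦ ε(b) h`. -/
def proj : D.Biproduct →ₗ[k] MonoidAlgebra k G :=
  (TensorProduct.lid k _).toLinearMap ∘ₗ
    (Coalgebra.counit (R := k) (A := MonoidAlgebra k 𝒢)).rTensor _ ∘ₗ D.of.symm.toLinearMap

/-- The map `Π : A → k[𝒢]`, `b × h ↦ ε(h) b`. -/
def projB : D.Biproduct →ₗ[k] MonoidAlgebra k 𝒢 :=
  (TensorProduct.rid k _).toLinearMap ∘ₗ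
    (Coalgebra.counit (R := k) (A := MonoidAlgebra k G)).lTensor _ ∘ₗ D.of.symm.toLinearMap

/-- The map `J : k[𝒢] → A`, `b ↦ b × 1`. -/
def inclB : MonoidAlgebra k 𝒢 →ₗ[k] D.Biproduct :=
  D.of.toLinearMap ∘ₗ (TensorProduct.mk k _ _).flip (1 : MonoidAlgebra k G)

end BiproductDatum

/-- A linear map between coalgebras is a coalgebra map. -/
def IsCoalgMap {k C C' : Type*} [Field k] [AddCommGroup C] [Module k C] [Coalgebra k C]
    [AddCommGroup C'] [Module k C'] [Coalgebra k C'] (f : C →ₗ[k] C') : Prop :=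
  Coalgebra.counit ∘ₗ f = Coalgebra.counit ∧
    TensorProduct.map f f ∘ₗ Coalgebra.comul = Coalgebra.comul ∘ₗ f

namespace BiproductDatum

variable {k 𝒢 G : Type*} [Field k] [Group 𝒢] [Group G] (D : BiproductDatum k 𝒢 G)

/-- `Aut_Hopf(A, π)`: the Hopf algebra automorphisms `F` of `A` with `π ∘ F = π`, under
composition. -/
def autHopf : Subgroup (D.Biproduct ≃ₐ[k] D.Biproduct) where
  carrier := {F | IsCoalgMap F.toLinearMap ∧ D.proj ∘ₗ F.toLinearMap = D.proj}
  one_mem' := ⟨⟨rfl, by ext; simp⟩, rfl⟩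
  mul_mem' := by
    rintro F F' ⟨⟨h1, h2⟩, h3⟩ ⟨⟨h1', h2'⟩, h3'⟩
    have e : (F * F').toLinearMap = F.toLinearMap ∘ₗ F'.toLinearMap := rfl
    refine ⟨⟨?_, ?_⟩, ?_⟩
    · rw [e, ← LinearMap.comp_assoc, h1, h1']
    · rw [e, TensorProduct.map_comp, LinearMap.comp_assoc, h2', ← LinearMap.comp_assoc, h2,
        LinearMap.comp_assoc]
    · rw [e, ← LinearMap.comp_assoc, h3, h3']
  inv_mem' := by
    rintro F ⟨⟨h1, h2⟩, h3⟩
    have e : F.toLinearMap ∘ₗ F⁻¹.toLinearMap = LinearMap.id :=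
      LinearMap.ext fun x => F.apply_symm_apply x
    have e' : F⁻¹.toLinearMap ∘ₗ F.toLinearMap = LinearMap.id :=
      LinearMap.ext fun x => F.symm_apply_apply x
    refine ⟨⟨?_, ?_⟩, ?_⟩
    · conv_lhs => rw [← h1, LinearMap.comp_assoc, e, LinearMap.comp_id]
    · have h := congrArg (fun t => TensorProduct.map F⁻¹.toLinearMap F⁻¹.toLinearMap ∘ₗ t ∘ₗ
        F⁻¹.toLinearMap) h2
      simp only [LinearMap.comp_assoc, e, LinearMap.comp_id] at h
      rw [← h, ← LinearMap.comp_assoc, ← TensorProduct.map_comp, e', TensorProduct.map_id,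
        LinearMap.id_comp]
    · conv_lhs => rw [← h3, LinearMap.comp_assoc, e, LinearMap.comp_id]

/-- The left factor `F_L = Π ∘ F ∘ J` of `F ∈ Aut_Hopf(A, π)`. -/
def leftFactor (F : D.autHopf) : MonoidAlgebra k 𝒢 →ₗ[k] MonoidAlgebra k 𝒢 :=
  D.projB ∘ₗ (F : D.Biproduct ≃ₐ[k] D.Biproduct).toLinearMap ∘ₗ D.inclB

/-- The data of the biproduct `A' = k[𝒢] × k[𝐔]`: the group `G` is replaced by `𝐔`, with the
restricted action. -/
def restrict : BiproductDatum k 𝒢 D.bU where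
  act := D.act.comp D.bU.subtype
  θ := D.θ
  finite_orbit := D.finite_orbit
  diagonalizable := D.diagonalizable
  act_comm := fun g => D.act_comm g
  bU := ⊤
  bold := D.bold.trans Subgroup.topEquiv.symm
  bU_le_ker := fun g _ => D.bU_le_ker g.2
  bU_le_center := fun g _ => Subgroup.mem_center_iff.2 fun h =>
    Subtype.ext (Subgroup.mem_center_iff.1 (D.bU_le_center g.2) h)

end BiproductDatum

section Idempotents

variable {k 𝒢 : Type*} [Field k] [CommGroup 𝒢] {t : ℕ} {n : Fin t → ℕ} [∀ i, NeZero (n i)]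

/-- `𝐆 = ℤ/n₁ ⊕ ⋯ ⊕ ℤ/n_t`, the additive version of `𝒢`. -/
abbrev AddVersion (n : Fin t → ℕ) : Type := ∀ i, ZMod (n i)

/-- `ω^(𝐦) = ω₁^{m₁} ⋯ ω_t^{m_t}` with `ω_j = ω^{(n₁ ⋯ n_t)/n_j}`. -/
def formalPow (ω : k) (m : AddVersion n) : k :=
  ∏ j, (ω ^ ((∏ i, n i) / n j)) ^ (m j).val

/-- `e_𝐦 = ∑_𝐫 (ω^(𝐦𝐫)/|𝒢|) g^(𝐫)`, where `𝐫 ↦ g^(𝐫)` is a given isomorphism `𝐆 ≃ 𝒢`. -/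
def idem (φ : Multiplicative (AddVersion n) ≃* 𝒢) (ω : k) (m : AddVersion n) :
    MonoidAlgebra k 𝒢 :=
  ∑ r : AddVersion n,
    MonoidAlgebra.single (φ (Multiplicative.ofAdd r)) (formalPow ω (m * r) / (Nat.card 𝒢 : k))

end Idempotents

section Gamma

variable {k M : Type*} [Field k] [AddCommGroup M]

/-- The order of the automorphism `σ`. -/
def autOrder (σ : M ≃+ M) : ℕ := orderOf (σ.toEquiv : Equiv.Perm M)

/-- The pairs `(τ, α)` of a permutation `τ` and a character `α` of `M` that satisfy

* `τ ∘ σ = σ ∘ τ`, `α ∘ σ = α`, `α m ^ N = 1` with `N = |σ|`;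
* `τ (s - m) = τ s - τ (σ ^ ℓ m)` for all `s`, `m`, where `0 ≤ ℓ < |m|` is the (unique) integer
  with `(α s / α m) ^ (N / |m|) = λ_m ^ ℓ`; here `|m|` is the length of the `σ`-orbit of `m`
  and `λ_m = λ ^ (N / |m|)`. -/
structure IsGammaPair (lam : kˣ) (σ : M ≃+ M) (τ : Equiv.Perm M) (α : AddChar M kˣ) : Prop where
  perm_comm : ∀ m, τ (σ m) = σ (τ m)
  char_comp : ∀ m, α (σ m) = α m
  char_pow : ∀ m, α m ^ autOrder σ = 1
  map_sub : ∀ s m, ∃ l : ℕ, l < Function.minimalPeriod σ m ∧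
    (α s / α m) ^ (autOrder σ / Function.minimalPeriod σ m) =
      (lam ^ (autOrder σ / Function.minimalPeriod σ m)) ^ l ∧
    τ (s - m) = τ s - τ (σ^[l] m)

theorem minimalPeriod_perm {lam : kˣ} {σ : M ≃+ M} {τ : Equiv.Perm M} {α : AddChar M kˣ}
    (h : IsGammaPair lam σ τ α) (m : M) :
    Function.minimalPeriod σ (τ m) = Function.minimalPeriod σ m := by
  have hs : Function.Semiconj τ σ σ := h.perm_comm
  refine Function.minimalPeriod_eq_minimalPeriod_iff.2 fun j => ?_
  unfold Function.IsPeriodicPt Function.IsFixedPt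
  rw [← (hs.iterate_right j).eq m, τ.injective.eq_iff]

theorem IsGammaPair.comm_pow {lam : kˣ} {σ : M ≃+ M} {τ : Equiv.Perm M} {α : AddChar M kˣ}
    (h : IsGammaPair lam σ τ α) (l : ℕ) (m : M) : τ (σ^[l] m) = σ^[l] (τ m) := by
  have hs : Function.Semiconj τ σ σ := h.perm_comm
  rw [(hs.iterate_right l).eq m]

theorem char_pow_apply {σ : M ≃+ M} {β : AddChar M kˣ} (hβ : ∀ m, β (σ m) = β m)
    (l : ℕ) (m : M) : β (σ^[l] m) = β m := by
  induction l with
  | zero => rfl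
  | succ l ih => rw [Function.iterate_succ_apply', hβ, ih]

theorem IsGammaPair.char_map_sub {lam : kˣ} {σ : M ≃+ M} {τ : Equiv.Perm M}
    {α : AddChar M kˣ} (h : IsGammaPair lam σ τ α) {β : AddChar M kˣ}
    (hβ : ∀ m, β (σ m) = β m) (s m : M) : β (τ (s - m)) = β (τ s) / β (τ m) := by
  obtain ⟨l, -, -, hl⟩ := h.map_sub s m
  rw [hl, AddChar.map_sub_eq_div, h.comm_pow, char_pow_apply hβ]

/-- For a `σ`-invariant character `β`, the character `β ∘ τ`. -/
def IsGammaPair.charComp {lam : kˣ} {σ : M ≃+ M} {τ : Equiv.Perm M}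
    {α : AddChar M kˣ} (h : IsGammaPair lam σ τ α) (β : AddChar M kˣ)
    (hβ : ∀ m, β (σ m) = β m) : AddChar M kˣ where
  toFun m := β (τ m)
  map_zero_eq_one' := by
    have := h.char_map_sub hβ 0 0
    rwa [sub_zero, div_self'] at this
  map_add_eq_mul' s m := by
    have := h.char_map_sub hβ (s + m) m
    rw [add_sub_cancel_right] at this
    rw [this, div_mul_cancel]

theorem isGammaPair_one [Finite M] (lam : kˣ) (σ : M ≃+ M) : IsGammaPair lam σ 1 1 where
  perm_comm _ := rfl
  char_comp _ := by simp
  char_pow _ := by simp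
  map_sub s m := ⟨0, Function.minimalPeriod_pos_of_mem_periodicPts
    (Function.Injective.mem_periodicPts σ.injective m), by simp, by simp⟩

theorem IsGammaPair.mul [Finite M] {lam : kˣ} {σ : M ≃+ M} (hlam : IsPrimitiveRoot lam (autOrder σ))
    {τ τ' : Equiv.Perm M} {α α' : AddChar M kˣ}
    (h : IsGammaPair lam σ τ α) (h' : IsGammaPair lam σ τ' α') :
    IsGammaPair lam σ (τ * τ') (α' * h'.charComp α h.char_comp) where
  perm_comm m := by
    rw [Equiv.Perm.mul_apply, h'.perm_comm, h.perm_comm, Equiv.Perm.mul_apply]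
  char_comp m := by
    change α' (σ m) * α (τ' (σ m)) = α' m * α (τ' m)
    rw [h'.char_comp, h'.perm_comm, h.char_comp]
  char_pow m := by
    change (α' m * α (τ' m)) ^ autOrder σ = 1
    rw [mul_pow, h.char_pow, h'.char_pow, one_mul]
  map_sub s m := by
    obtain ⟨l', hl', e', q'⟩ := h'.map_sub s m
    obtain ⟨l, hl, e, q⟩ := h.map_sub (τ' s) (τ' (σ^[l'] m))
    have hp : ∀ j, Function.minimalPeriod σ (σ^[j] m) = Function.minimalPeriod σ m := fun j =>
      Function.minimalPeriod_apply_iterate (Function.Injective.mem_periodicPts σ.injective m) j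
    have hd : Function.minimalPeriod σ m ∣ autOrder σ := by
      rw [← Function.isPeriodicPt_iff_minimalPeriod_dvd]
      change σ^[autOrder σ] m = m
      have h1 := Equiv.Perm.iterate_eq_pow (σ.toEquiv : Equiv.Perm M) (autOrder σ)
      rw [autOrder, pow_orderOf_eq_one] at h1
      exact congrFun h1 m
    rw [minimalPeriod_perm h', hp, h'.comm_pow, char_pow_apply h.char_comp] at e
    have hpos := Function.minimalPeriod_pos_of_mem_periodicPts
      (Function.Injective.mem_periodicPts σ.injective m)
    refine ⟨(l + l') % Function.minimalPeriod σ m, Nat.mod_lt _ hpos, ?_, ?_⟩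
    · have hl1 : (lam ^ (autOrder σ / Function.minimalPeriod σ m)) ^ Function.minimalPeriod σ m
          = 1 := by
        rw [← pow_mul, Nat.div_mul_cancel hd, hlam.pow_eq_one]
      rw [← pow_eq_pow_mod _ hl1]
      change ((α' s * α (τ' s)) / (α' m * α (τ' m))) ^ _ = _
      rw [mul_div_mul_comm, mul_pow, e, e', ← pow_add, add_comm]
    · rw [Function.iterate_mod_minimalPeriod_eq, Equiv.Perm.mul_apply, q', q,
        Function.iterate_add_apply, Equiv.Perm.mul_apply, Equiv.Perm.mul_apply, h'.comm_pow]
      rw [h'.comm_pow, h'.comm_pow]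

/-- The group `Γ(𝐆, λ, σ)` of those `τ` for which `(τ, α)` is an admissible pair for some `α`. -/
def Gamma [Finite M] (lam : kˣ) (σ : M ≃+ M) (hlam : IsPrimitiveRoot lam (autOrder σ)) :
    Subgroup (Equiv.Perm M) where
  carrier := {τ | ∃ α : AddChar M kˣ, IsGammaPair lam σ τ α}
  one_mem' := ⟨1, isGammaPair_one lam σ⟩
  mul_mem' := by
    rintro τ τ' ⟨α, h⟩ ⟨α', h'⟩
    exact ⟨_, h.mul hlam h'⟩
  inv_mem' := by
    rintro τ ⟨α, h⟩
    have hpow : ∀ j : ℕ, ∃ α : AddChar M kˣ, IsGammaPair lam σ (τ ^ j) α := fun j => by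
      induction j with
      | zero => exact ⟨1, isGammaPair_one lam σ⟩
      | succ j ih =>
        obtain ⟨β, hβ⟩ := ih
        rw [pow_succ]
        exact ⟨_, hβ.mul hlam h⟩
    have hinv : τ⁻¹ = τ ^ (orderOf τ - 1) := by
      rw [inv_eq_iff_mul_eq_one, mul_pow_sub_one (orderOf_pos τ).ne', pow_orderOf_eq_one]
    change ∃ α : AddChar M kˣ, IsGammaPair lam σ τ⁻¹ α
    rw [hinv]
    exact hpow _

end Gamma

end

/-! Write M for the additive version of 𝒢. Since 𝐔 acts trivially, the algebra A' is the tensor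
product of k[𝒢] and k[𝐔]. Both factors are group algebras of finite abelian groups with enough roots
of unity in k, so each has a basis of orthogonal idempotents: e_m with m ∈ M, and E_c with c ∈ ℤ/N,
because 𝐔 is cyclic of order N, generated by 𝛌. Hence A' is the algebra of functions on M × ℤ/N,
with the elements e_m × E_c as delta functions.

The coaction sends e_s to ∑ E_j ⊗ e_{σ^j s}, and so Δ x_p = ∑ x_q ⊗ x_{q⁻¹p} for the group law of a
semidirect product of M and ℤ/N, where ℤ/N acts through σ (`comul_biproductBasis`). Algebra
automorphisms permute the basis (`exists_perm_of_algEquiv`), and those that respect Δ are the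
automorphisms of this group (`map_comp_comul_iff`). The condition π' ∘ F = π' says that F fixes
every (0, c).

Such a group automorphism is (m, c) ↦ (τ m, κ m + c), where τ commutes with σ, the map κ is additive
and σ-invariant, and τ (p + q) = τ p + σ^(-κ p) (τ q). With α = λ^(-κ) these are exactly the
admissible pairs (`isGammaPair_iff_isTwistedPair`), and Fourier inversion on ℤ/N turns the shift by
κ into the factor α(s)^ℓ of (c). As σ has order exactly N, τ determines κ and hence α, so forgetting
α loses nothing and Γ is isomorphic to the automorphism group. For (b), k[𝒢] itself is the function
algebra of M, so F_L is a coalgebra map exactly when τ is additive. -/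

/-! ### Powers with exponents in ℤ/N. -/

theorem pow_val_add {X : Type*} [Monoid X] {N : ℕ} [NeZero N] {x : X} (hx : x ^ N = 1)
    (a b : ZMod N) : x ^ (a + b).val = x ^ a.val * x ^ b.val := by
  rw [ZMod.val_add, ← pow_add, ← pow_eq_pow_mod _ hx]

theorem pow_val_natCast {X : Type*} [Monoid X] {N : ℕ} {x : X} (hx : x ^ N = 1)
    (l : ℕ) : x ^ (l : ZMod N).val = x ^ l := by
  rw [ZMod.val_natCast, ← pow_eq_pow_mod _ hx]

theorem pow_val_neg {X : Type*} [Group X] {N : ℕ} [NeZero N] {x : X} (hx : x ^ N = 1)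
    (a : ZMod N) : x ^ (-a).val = (x ^ a.val)⁻¹ := by
  rw [eq_inv_iff_mul_eq_one, ← pow_val_add hx, neg_add_cancel, ZMod.val_zero, pow_zero]

theorem pow_val_injective {X : Type*} [Group X] {N : ℕ} [NeZero N] {x : X} (hx : orderOf x = N) :
    Function.Injective fun a : ZMod N => x ^ a.val := fun a b h =>
  ZMod.val_injective N <|
    pow_injOn_Iio_orderOf (by simpa [hx] using a.val_lt) (by simpa [hx] using b.val_lt) h

/-! ### Fourier analysis on a finite abelian group with a self-duality. -/

/-- A symmetric nondegenerate bicharacter on a finite abelian group with values in a field. -/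
structure IsSymmBichar {k M : Type*} [Field k] [AddCommGroup M] (χ : M → M → k) : Prop where
  card_ne : (Nat.card M : k) ≠ 0
  symm : ∀ a b, χ a b = χ b a
  zero_left : ∀ r, χ 0 r = 1
  add_left : ∀ a b r, χ (a + b) r = χ a r * χ b r
  nondeg : ∀ a, a ≠ 0 → ∃ r, χ a r ≠ 1

/-- The idempotent `|X|⁻¹ ∑ χ(m, r) φ(r)` of the group algebra `k[X]`. -/
noncomputable def dualIdem {k M X : Type*} [Field k] [AddCommGroup M] [Fintype M] [Group X]
    (φ : Multiplicative M ≃* X) (χ : M → M → k) (m : M) : MonoidAlgebra k X :=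
  ∑ r : M, MonoidAlgebra.single (φ (Multiplicative.ofAdd r)) (χ m r / (Nat.card X : k))

namespace IsSymmBichar

section Characters

variable {k M : Type*} [Field k] [AddCommGroup M] {χ : M → M → k} (h : IsSymmBichar χ)
include h

theorem add_right (a r s : M) : χ a (r + s) = χ a r * χ a s := by
  rw [h.symm, h.add_left, h.symm r, h.symm s]

theorem zero_right (a : M) : χ a 0 = 1 := by rw [h.symm, h.zero_left]

theorem mul_neg_left (a r : M) : χ a r * χ (-a) r = 1 := by
  rw [← h.add_left, add_neg_cancel, h.zero_left]

theorem ne_zero (a r : M) : χ a r ≠ 0 := left_ne_zero_of_mul_eq_one (h.mul_neg_left a r)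

theorem neg_comm (a r : M) : χ a (-r) = χ (-a) r := by
  have h1 : χ a r * χ a (-r) = 1 := by rw [← h.add_right, add_neg_cancel, h.zero_right]
  exact mul_left_cancel₀ (h.ne_zero a r) (h1.trans (h.mul_neg_left a r).symm)

theorem injective : Function.Injective χ := fun a b hab => by
  by_contra hne
  obtain ⟨r, hr⟩ := h.nondeg (a - b) (sub_ne_zero.2 hne)
  apply hr
  rw [sub_eq_add_neg, h.add_left, hab, h.mul_neg_left]

variable [Fintype M]

open Classical in
theorem sum_right (a : M) : ∑ r, χ a r = if a = 0 then (Nat.card M : k) else 0 := by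
  split_ifs with ha
  · subst ha
    simp [h.zero_left]
  · obtain ⟨s, hs⟩ := h.nondeg a ha
    have h1 : χ a s * ∑ r, χ a r = ∑ r, χ a r := by
      rw [Finset.mul_sum]
      simp only [← h.add_right]
      exact Fintype.sum_equiv (Equiv.addLeft s) _ _ fun _ => rfl
    by_contra h0
    exact hs (mul_right_cancel₀ h0 (h1.trans (one_mul _).symm))

open Classical in
theorem sum_left (r : M) : ∑ a, χ a r = if r = 0 then (Nat.card M : k) else 0 := by
  simp only [h.symm _ r, h.sum_right]

open Classical in
theorem sum_right_div (a : M) : ∑ r, χ a r / (Nat.card M : k) = if a = 0 then 1 else 0 := by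
  rw [← Finset.sum_div, h.sum_right]
  split_ifs
  · exact div_self h.card_ne
  · exact zero_div _

/-- Every character is of the form `χ(a, ·)`. -/
theorem exists_eq (f : M → k) (h0 : f 0 = 1) (hadd : ∀ r s, f (r + s) = f r * f s) :
    ∃ a, ∀ r, f r = χ a r := by
  classical
  by_contra! hne
  -- Orthogonality: a character different from every χ(a, ·) has all Fourier coefficients zero. Yet
  -- the coefficients add up to |M| f(0) = |M| ≠ 0.
  have hz : ∀ a, ∑ r, f r * χ a (-r) = 0 := fun a => by
    obtain ⟨s, hs⟩ := hne a
    have h1 : (f s * χ a (-s)) * ∑ r, f r * χ a (-r) = ∑ r, f r * χ a (-r) := by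
      rw [Finset.mul_sum]
      refine Fintype.sum_equiv (Equiv.addLeft s) _ _ fun r => ?_
      simp only [Equiv.coe_addLeft, hadd, neg_add, h.add_right]
      ring
    by_contra hn
    have h2 : f s * χ a (-s) = 1 := mul_right_cancel₀ hn (h1.trans (one_mul _).symm)
    apply hs
    rw [h.neg_comm] at h2
    rw [← mul_one (f s), ← h.mul_neg_left a s, mul_comm (χ a s), ← mul_assoc, h2, one_mul]
  have h3 : ∑ a, ∑ r, f r * χ a (-r) = (Nat.card M : k) := by
    rw [Finset.sum_comm]
    simp only [← Finset.mul_sum, h.sum_left, neg_eq_zero]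
    simp [h0]
  simp only [hz, Finset.sum_const_zero] at h3
  exact h.card_ne h3.symm

end Characters

section DualIdem

variable {k M X : Type*} [Field k] [AddCommGroup M] [Fintype M] [Group X]
  {χ : M → M → k} (φ : Multiplicative M ≃* X)

theorem dualIdem_eq (a : M) : dualIdem φ χ a = ∑ r, (χ a r / (Nat.card M : k)) •
    MonoidAlgebra.single (φ (Multiplicative.ofAdd r)) (1 : k) := by
  rw [Nat.card_congr (Multiplicative.ofAdd.trans φ.toEquiv)]
  simp [dualIdem]

variable (h : IsSymmBichar χ)
include h

/-- Fourier inversion, by the orthogonality relation in the first variable of χ. -/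
theorem single_eq_sum (r : M) : MonoidAlgebra.single (φ (Multiplicative.ofAdd r)) (1 : k) =
    ∑ m, χ m (-r) • dualIdem φ χ m := by
  classical
  have h2 : ∀ s, ∑ m, χ m (-r) * (χ m s / (Nat.card M : k)) = if s = r then 1 else 0 := fun s => by
    simp only [← mul_div_assoc, ← h.add_right, h.symm _ (-r + s), h.sum_right_div,
      neg_add_eq_zero, eq_comm]
  simp only [dualIdem_eq, Finset.smul_sum, smul_smul]
  rw [Finset.sum_comm]
  simp only [← Finset.sum_smul, h2]
  simp

theorem single_mul_dualIdem (r m : M) :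
    MonoidAlgebra.single (φ (Multiplicative.ofAdd r)) (1 : k) * dualIdem φ χ m =
      χ m (-r) • dualIdem φ χ m := by
  simp only [dualIdem, Finset.mul_sum, Finset.smul_sum, MonoidAlgebra.smul_single,
    MonoidAlgebra.single_mul_single, one_mul, smul_eq_mul]
  refine Fintype.sum_equiv (Equiv.addLeft r) _ _ fun s => ?_
  rw [Equiv.coe_addLeft, ← mul_div_assoc, ← h.add_right, neg_add_cancel_left, ofAdd_add, map_mul]

-- Only the left factor is expanded: each group element acts on the right idempotent by a scalar,
-- and the scalars sum to the orthogonality relation for a - b.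
open Classical in
theorem dualIdem_mul (a b : M) :
    dualIdem φ χ a * dualIdem φ χ b = if a = b then dualIdem φ χ a else 0 := by
  have h2 : ∑ r, χ a r / (Nat.card M : k) * χ b (-r) = if a = b then 1 else 0 := by
    simp only [← sub_eq_zero (a := a) (b := b), h.neg_comm]
    rw [← h.sum_right_div]
    refine Finset.sum_congr rfl fun r _ => ?_
    rw [sub_eq_add_neg, h.add_left]
    ring
  conv_lhs => rw [dualIdem_eq φ a]
  simp only [Finset.sum_mul, smul_mul_assoc, single_mul_dualIdem φ h, smul_smul,
    ← Finset.sum_smul, h2]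
  split_ifs with hab
  · rw [one_smul, hab]
  · rw [zero_smul]

theorem sum_dualIdem : ∑ m, dualIdem φ χ m = 1 := by
  have := single_eq_sum φ h 0
  simp only [neg_zero, h.zero_right, one_smul, ofAdd_zero, map_one] at this
  exact this.symm

theorem dualIdem_ne_zero (m : M) : dualIdem φ χ m ≠ 0 := fun h0 => by
  classical
  have h3 := DFunLike.congr_fun (congrArg MonoidAlgebra.coeff h0)
    (φ (Multiplicative.ofAdd 0))
  simp [dualIdem_eq, Finsupp.single_apply, h.zero_right] at h3
  exact h.card_ne (by simpa using h3)

open Classical in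
theorem counit_dualIdem (m : M) :
    Coalgebra.counit (R := k) (dualIdem φ χ m) = if m = 0 then 1 else 0 := by
  rw [← h.sum_right_div, dualIdem_eq]
  simp

/-- Group elements are group-like. Fourier inversion in the second tensor factor alone leaves the
coefficients χ(m, r) χ(s, -r) = χ(m - s, r) in the first. Thus Δ is dual to the addition of M. -/
theorem comul_dualIdem (m : M) : Coalgebra.comul (R := k) (dualIdem φ χ m) =
    ∑ s, dualIdem φ χ (m - s) ⊗ₜ[k] dualIdem φ χ s := by
  have h2 : ∀ r, Coalgebra.comul (R := k)
      (MonoidAlgebra.single (φ (Multiplicative.ofAdd r)) (1 : k)) =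
      ∑ s, χ s (-r) • MonoidAlgebra.single (φ (Multiplicative.ofAdd r)) (1 : k) ⊗ₜ[k]
        dualIdem φ χ s := fun r => by
    have h3 : Coalgebra.comul (R := k)
        (MonoidAlgebra.single (φ (Multiplicative.ofAdd r)) (1 : k)) =
        MonoidAlgebra.single (φ (Multiplicative.ofAdd r)) (1 : k) ⊗ₜ
          MonoidAlgebra.single (φ (Multiplicative.ofAdd r)) (1 : k) := by simp
    rw [h3]
    conv_lhs => rhs; rw [single_eq_sum φ h r]
    rw [TensorProduct.tmul_sum]
    exact Finset.sum_congr rfl fun s _ => by rw [TensorProduct.tmul_smul, TensorProduct.smul_tmul']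
  conv_lhs => rw [dualIdem_eq]
  simp only [map_sum, map_smul, h2, Finset.smul_sum]
  rw [Finset.sum_comm]
  refine Finset.sum_congr rfl fun s _ => ?_
  rw [dualIdem_eq φ (m - s), TensorProduct.sum_tmul]
  refine Finset.sum_congr rfl fun r _ => ?_
  rw [smul_smul, TensorProduct.smul_tmul', h.neg_comm, sub_eq_add_neg, h.add_left]
  congr 2
  ring

end DualIdem

end IsSymmBichar

/-! ### Algebras with a basis of orthogonal idempotents. -/

section OrthogonalBasis

open Module

variable {k A Q : Type*} [Field k] [Ring A] [Algebra k A]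

theorem linearIndependent_of_orthogonal [DecidableEq Q] {x : Q → A}
    (hmul : ∀ p q, x p * x q = if p = q then x p else 0) (hne : ∀ p, x p ≠ 0) :
    LinearIndependent k x := by
  refine linearIndependent_iff'.2 fun s c hc p hp => ?_
  have h1 := congrArg (x p * ·) hc
  simp only [Finset.mul_sum, mul_smul_comm, hmul, mul_zero, smul_ite, smul_zero,
    Finset.sum_ite_eq, hp, if_true] at h1
  exact (smul_eq_zero.1 h1).resolve_right (hne p)

variable [Fintype Q] (x : Basis Q k A)

/-- Algebra automorphisms permute a basis of orthogonal idempotents. -/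
theorem exists_perm_of_algEquiv [DecidableEq Q] (hmul : ∀ p q, x p * x q = if p = q then x p else 0)
    (hone : ∑ p, x p = 1) (F : A ≃ₐ[k] A) :
    ∃ P : Equiv.Perm Q, ∀ p, F (x p) = x (P p) := by
  -- The q-th coordinate of a is the scalar by which a acts on x_q, so it is multiplicative in a: it
  -- is evaluation at the point q.
  have hev : ∀ a q, a * x q = x.repr a q • x q := fun a q => by
    conv_lhs => rw [← x.sum_repr a]
    simp only [Finset.sum_mul, smul_mul_assoc, hmul, smul_ite, smul_zero]
    simp
  have hevmul : ∀ a b q, x.repr (a * b) q = x.repr a q * x.repr b q := fun a b q => by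
    apply smul_left_injective k (x.ne_zero q)
    change x.repr (a * b) q • x q = (x.repr a q * x.repr b q) • x q
    rw [← hev, mul_assoc, hev b, mul_smul_comm, hev a, smul_smul, mul_comm]
  have horth : ∀ q p p', x.repr (F (x p)) q * x.repr (F (x p')) q =
      if p = p' then x.repr (F (x p)) q else 0 := fun q p p' => by
    rw [← hevmul, ← map_mul, hmul]
    split_ifs <;> simp
  have hsum : ∀ q, ∑ p, x.repr (F (x p)) q = 1 := fun q => by
    have h1 : ∑ p, x.repr (F (x p)) q = x.repr (F (∑ p, x p)) q := by simp
    have h2 := hev 1 q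
    rw [one_mul] at h2
    rw [h1, hone, map_one]
    apply smul_left_injective k (x.ne_zero q)
    simp only [one_smul, ← h2]
  -- For fixed q the coordinates of the F(x_p) are orthogonal idempotents of the field k with sum 1,
  -- so exactly one of them is 1. Its index is r q, and the required permutation is the inverse of
  -- r.
  have hex : ∀ q, ∃ p, x.repr (F (x p)) q ≠ 0 := fun q => by
    by_contra! h0
    simpa [h0] using hsum q
  choose r hr using hex
  have hc : ∀ p q, x.repr (F (x p)) q = if r q = p then 1 else 0 := fun p q => by
    split_ifs with hp
    · have := horth q p p
      subst hp
      rw [if_pos rfl] at this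
      exact mul_right_cancel₀ (hr q) (this.trans (one_mul _).symm)
    · have := horth q (r q) p
      rw [if_neg hp] at this
      exact (mul_eq_zero.1 this).resolve_left (hr q)
  have hsurj : Function.Surjective r := fun p => by
    by_contra! h0
    have h1 : x.repr (F (x p)) = 0 := Finsupp.ext fun q => by simp [hc, h0 q]
    exact x.ne_zero p (F.injective (by simpa using h1))
  refine ⟨(Equiv.ofBijective r ⟨Finite.injective_iff_surjective.2 hsurj, hsurj⟩).symm,
    fun p => ?_⟩
  rw [← x.sum_repr (F (x p))]
  simp only [hc, ite_smul, one_smul, zero_smul]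
  rw [Finset.sum_eq_single ((Equiv.ofBijective r
    ⟨Finite.injective_iff_surjective.2 hsurj, hsurj⟩).symm p), if_pos]
  · exact Equiv.ofBijective_apply_symm_apply r _ p
  · intro q _ hq
    rw [if_neg]
    rintro rfl
    exact hq (Equiv.ofBijective_symm_apply_apply r _ q).symm
  · simp

/-- A permutation of a basis of orthogonal idempotents extends to an algebra automorphism. -/
theorem exists_algEquiv_of_perm [DecidableEq Q] (hmul : ∀ p q, x p * x q = if p = q then x p else 0)
    (hone : ∑ p, x p = 1) (P : Equiv.Perm Q) :
    ∃ F : A ≃ₐ[k] A, ∀ p, F (x p) = x (P p) := by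
  refine ⟨AlgEquiv.ofLinearEquiv (x.equiv x P) ?_ ?_, fun p => x.equiv_apply p x P⟩
  · conv_lhs => rw [← hone]
    rw [map_sum, ← hone, ← Equiv.sum_comp P x]
    exact Finset.sum_congr rfl fun p _ => x.equiv_apply p x P
  · refine (LinearMap.map_mul_iff (x.equiv x P).toLinearMap).2 ?_
    refine x.ext fun p => x.ext fun q => ?_
    simp only [LinearMap.compr₂_apply, LinearMap.mul_apply', LinearMap.compl₂_apply,
      LinearMap.comp_apply, LinearEquiv.coe_coe, Basis.equiv_apply, hmul,
      P.injective.eq_iff]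
    split_ifs <;> simp

/-- Let `x` be a basis with `Δ x_p = ∑ x_q ⊗ x_{q \ p}`. A linear map that permutes `x` respects
the comultiplication if and only if the permutation respects the operation `q \ p`. -/
theorem map_comp_comul_iff {k A Q : Type*} [Field k] [AddCommGroup A] [Module k A]
    [Coalgebra k A] [Fintype Q] (x : Basis Q k A)
    (ld : Q → Q → Q)
    (hx : ∀ p, Coalgebra.comul (R := k) (x p) = ∑ q, x q ⊗ₜ[k] x (ld q p)) (f : A →ₗ[k] A)
    (P : Equiv.Perm Q) (hf : ∀ p, f (x p) = x (P p)) :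
    TensorProduct.map f f ∘ₗ Coalgebra.comul = Coalgebra.comul ∘ₗ f ↔
      ∀ q p, P (ld q p) = ld (P q) (P p) := by
  classical
  have h1 : ∀ p, (TensorProduct.map f f ∘ₗ Coalgebra.comul) (x p) =
      ∑ q, x (P q) ⊗ₜ[k] x (P (ld q p)) := fun p => by
    simp [hx, hf]
  have h2 : ∀ p, (Coalgebra.comul ∘ₗ f) (x p) =
      ∑ q, x (P q) ⊗ₜ[k] x (ld (P q) (P p)) := fun p => by
    rw [LinearMap.comp_apply, hf, hx]
    exact (Fintype.sum_equiv P _ _ fun _ => rfl).symm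
  constructor
  · intro h q p
    have h3 := LinearMap.congr_fun h (x p)
    rw [h1, h2] at h3
    -- This coefficient is 1 on the left. On the right only the q-th term has the first index P q,
    -- so the coefficient is 0 unless the second indices agree.
    have h4 := congrArg (fun t => (x.tensorProduct x).repr t (P q, P (ld q p))) h3
    simp only [map_sum, Finsupp.coe_finsetSum, Finset.sum_apply,
      Basis.tensorProduct_repr_tmul_apply, Basis.repr_self, Finsupp.single_apply,
      P.injective.eq_iff] at h4
    by_contra hne
    simp [Ne.symm hne] at h4
  · intro h
    refine x.ext fun p => ?_
    rw [h1, h2]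
    simp only [h]

end OrthogonalBasis

/-! ### Automorphisms of the semidirect product and admissible pairs. -/

theorem mul_div_modEq_iff {N d a b : ℕ} (hN : N ≠ 0) (hd : d ∣ N) :
    a * (N / d) ≡ b * (N / d) [MOD N] ↔ a ≡ b [MOD d] := by
  obtain ⟨e, rfl⟩ := hd
  rw [mul_ne_zero_iff] at hN
  rw [Nat.mul_div_cancel_left e (Nat.pos_of_ne_zero hN.1)]
  exact ⟨Nat.ModEq.mul_right_cancel' hN.2, Nat.ModEq.mul_right' e⟩

section TwistedPermutations

variable {M : Type*} [AddCommGroup M] (σ : M ≃+ M)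

theorem iterate_autOrder : σ^[autOrder σ] = id := by
  have h1 := Equiv.Perm.iterate_eq_pow (σ.toEquiv : Equiv.Perm M) (autOrder σ)
  rw [autOrder, pow_orderOf_eq_one] at h1
  exact h1

theorem autOrder_ne_zero [Finite M] : autOrder σ ≠ 0 :=
  (orderOf_pos (σ.toEquiv : Equiv.Perm M)).ne'

theorem minimalPeriod_dvd_autOrder (m : M) : Function.minimalPeriod σ m ∣ autOrder σ := by
  rw [← Function.isPeriodicPt_iff_minimalPeriod_dvd]
  exact congrFun (iterate_autOrder σ) m

theorem iterate_eq_of_modEq {m : M} {i j : ℕ} (h : i ≡ j [MOD Function.minimalPeriod σ m]) :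
    σ^[i] m = σ^[j] m := by
  rw [← Function.iterate_mod_minimalPeriod_eq, h, Function.iterate_mod_minimalPeriod_eq]

/-- The congruence modulo the orbit length covers N = 1 as well, where `(1 : ZMod 1).val` is 0 and σ
is the identity. -/
theorem iterate_val_one (m : M) : σ^[(1 : ZMod (autOrder σ)).val] m = σ m := by
  refine (iterate_eq_of_modEq σ (j := 1) ?_).trans rfl
  refine Nat.ModEq.of_dvd (minimalPeriod_dvd_autOrder σ m) ?_
  rw [← Nat.cast_one, ZMod.val_natCast]
  exact Nat.mod_modEq _ _

section

variable [NeZero (autOrder σ)]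

theorem iterate_val_add (a b : ZMod (autOrder σ)) (m : M) :
    σ^[(a + b).val] m = σ^[a.val] (σ^[b.val] m) := by
  rw [← Function.iterate_add_apply]
  apply iterate_eq_of_modEq
  refine Nat.ModEq.of_dvd (minimalPeriod_dvd_autOrder σ m) ?_
  rw [ZMod.val_add]
  exact Nat.mod_modEq _ _

theorem iterate_val_neg (a : ZMod (autOrder σ)) (m : M) :
    σ^[(-a).val] (σ^[a.val] m) = m := by
  rw [← iterate_val_add, neg_add_cancel, ZMod.val_zero, Function.iterate_zero, id]

theorem iterate_val_neg' (a : ZMod (autOrder σ)) (m : M) :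
    σ^[a.val] (σ^[(-a).val] m) = m := by
  rw [← iterate_val_add, add_neg_cancel, ZMod.val_zero, Function.iterate_zero, id]

end

/-- The conditions on `(τ, κ)` under which `(m, c) ↦ (τ m, κ m + c)` is an automorphism of the
semidirect product of `M` and `ℤ/|σ|`. -/
structure IsTwistedPair (τ : Equiv.Perm M) (κ : M → ZMod (autOrder σ)) : Prop where
  perm_comm : ∀ m, τ (σ m) = σ (τ m)
  comp : ∀ m, κ (σ m) = κ m
  add : ∀ p q, κ (p + q) = κ p + κ q
  perm_add : ∀ p q, τ (p + q) = τ p + σ^[(-κ p).val] (τ q)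

/-- The operation `q⁻¹ p` of the semidirect product of `M` and `ℤ/|σ|`. -/
noncomputable def semiLd (q p : M × ZMod (autOrder σ)) : M × ZMod (autOrder σ) :=
  (σ^[q.2.val] (p.1 - q.1), p.2 - q.2)

variable {σ}

theorem IsTwistedPair.comm_iterate {τ : Equiv.Perm M} {κ : M → ZMod (autOrder σ)}
    (h : IsTwistedPair σ τ κ) (l : ℕ) (m : M) : τ (σ^[l] m) = σ^[l] (τ m) := by
  have hs : Function.Semiconj τ σ σ := h.perm_comm
  rw [(hs.iterate_right l).eq m]

theorem IsTwistedPair.comp_iterate {τ : Equiv.Perm M} {κ : M → ZMod (autOrder σ)}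
    (h : IsTwistedPair σ τ κ) (l : ℕ) (m : M) : κ (σ^[l] m) = κ m := by
  induction l with
  | zero => rfl
  | succ l ih => rw [Function.iterate_succ_apply', h.comp, ih]

variable [NeZero (autOrder σ)]

theorem exists_isTwistedPair [Finite M] {P : Equiv.Perm (M × ZMod (autOrder σ))}
    (hld : ∀ q p, P (semiLd σ q p) = semiLd σ (P q) (P p)) (hfix : ∀ c, P (0, c) = (0, c)) :
    ∃ (τ : Equiv.Perm M) (κ : M → ZMod (autOrder σ)), IsTwistedPair σ τ κ ∧
      ∀ m c, P (m, c) = (τ m, κ m + c) := by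
  -- In the group, (m, 0)⁻¹ (m, c) = (0, c), which P fixes. So P is determined by its values P (m,
  -- 0) = (τ m, κ m).
  have hP : ∀ m c, P (m, c) = ((P (m, 0)).1, (P (m, 0)).2 + c) := fun m c => by
    have h1 := hld (m, 0) (m, c)
    simp only [semiLd, sub_self, iterate_map_zero, sub_zero, hfix, Prod.mk.injEq] at h1
    have h2 := congrArg (σ^[(-(P (m, 0)).2).val]) h1.1
    rw [iterate_val_neg, iterate_map_zero] at h2
    exact Prod.ext (sub_eq_zero.1 h2.symm) (sub_eq_iff_eq_add'.1 h1.2.symm)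
  have hinj : Function.Injective fun m => (P (m, 0)).1 := fun m m' h => by
    -- Shifting the second coordinate by -κ makes it vanish in the image, so that only τ m and τ m'
    -- are compared.
    have h1 : P (m, -(P (m, 0)).2) = P (m', -(P (m', 0)).2) := by
      rw [hP m, hP m', add_neg_cancel, add_neg_cancel]
      exact Prod.ext h rfl
    exact congrArg Prod.fst (P.injective h1)
  have hsub : ∀ m s, P (s - m, 0) = (σ^[(P (m, 0)).2.val] ((P (s, 0)).1 - (P (m, 0)).1),
      (P (s, 0)).2 - (P (m, 0)).2) := fun m s => by
    have h1 := hld (m, 0) (s, 0)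
    simpa [semiLd] using h1
  have hσ : ∀ m, P (σ m, 0) = (σ (P (m, 0)).1, (P (m, 0)).2) := fun m => by
    -- Here (0, 1)⁻¹ (m, 1) = (σ m, 0): conjugation by the fixed element (0, 1) gives σ, so τ
    -- commutes with σ and κ is σ-invariant.
    have h1 := hld (0, 1) (m, 1)
    simp only [semiLd, hfix, sub_zero, iterate_val_one, sub_self, hP m 1,
      add_sub_cancel_right] at h1
    exact h1
  refine ⟨Equiv.ofBijective _ ⟨hinj, Finite.surjective_of_injective hinj⟩,
    fun m => (P (m, 0)).2, ⟨fun m => ?_, fun m => ?_, fun p q => ?_, fun p q => ?_⟩, hP⟩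
  · exact (Prod.ext_iff.1 (hσ m)).1
  · exact (Prod.ext_iff.1 (hσ m)).2
  · have h1 := congrArg Prod.snd (hsub p (p + q))
    rw [add_sub_cancel_left] at h1
    exact (sub_eq_iff_eq_add'.1 h1.symm)
  · have h1 := congrArg (fun t => σ^[(-(P (p, 0)).2).val] t.1) (hsub p (p + q))
    simp only [add_sub_cancel_left, iterate_val_neg] at h1
    exact (sub_eq_iff_eq_add'.1 h1.symm)

theorem IsTwistedPair.map_zero {τ : Equiv.Perm M} {κ : M → ZMod (autOrder σ)}
    (h : IsTwistedPair σ τ κ) : τ 0 = 0 := by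
  have h1 := h.perm_add 0 0
  rw [add_zero, left_eq_add] at h1
  rw [← iterate_val_neg' σ (κ 0) (τ 0), h1, iterate_map_zero]

theorem IsTwistedPair.exists_perm {τ : Equiv.Perm M} {κ : M → ZMod (autOrder σ)}
    (h : IsTwistedPair σ τ κ) :
    ∃ P : Equiv.Perm (M × ZMod (autOrder σ)),
      (∀ q p, P (semiLd σ q p) = semiLd σ (P q) (P p)) ∧ (∀ c, P (0, c) = (0, c)) ∧
      ∀ m c, P (m, c) = (τ m, κ m + c) := by
  have h0 : κ 0 = 0 := by simpa using h.add 0 0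
  have hsub : ∀ a b, κ (a - b) = κ a - κ b := fun a b => by
    rw [eq_sub_iff_add_eq, ← h.add, sub_add_cancel]
  refine ⟨⟨fun p => (τ p.1, κ p.1 + p.2), fun p => (τ.symm p.1, p.2 - κ (τ.symm p.1)),
    fun p => by simp, fun p => by simp⟩, ?_, ?_, fun _ _ => rfl⟩
  · rintro ⟨q, a⟩ ⟨m, c⟩
    simp only [semiLd, Equiv.coe_fn_mk, Prod.mk.injEq]
    constructor
    · have h1 := h.perm_add q (m - q)
      rw [add_sub_cancel] at h1
      rw [h.comm_iterate, h1, add_sub_cancel_left, add_comm (κ q), iterate_val_add,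
        iterate_val_neg']
    · rw [h.comp_iterate, hsub]
      abel
  · intro c
    simp [h0, h.map_zero]

/-- As τ is surjective, `perm_add` determines the permutation σ^(-κ p). Since σ has order exactly N,
this determines κ p in ℤ/N. -/
theorem IsTwistedPair.unique {τ : Equiv.Perm M} {κ κ' : M → ZMod (autOrder σ)}
    (h : IsTwistedPair σ τ κ) (h' : IsTwistedPair σ τ κ') : κ = κ' := by
  funext p
  have h1 : ∀ m, σ^[(-κ p).val] m = σ^[(-κ' p).val] m := fun m => by
    have h2 := (h.perm_add p (τ.symm m)).symm.trans (h'.perm_add p (τ.symm m))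
    simpa using h2
  apply neg_injective
  refine pow_val_injective (N := autOrder σ) (x := (σ.toEquiv : Equiv.Perm M)) rfl
    (Equiv.ext fun m => ?_)
  change (σ.toEquiv ^ (-κ p).val : Equiv.Perm M) m = (σ.toEquiv ^ (-κ' p).val : Equiv.Perm M) m
  rw [← Equiv.Perm.iterate_eq_pow, ← Equiv.Perm.iterate_eq_pow]
  exact h1 m

variable {k : Type*} [Field k] {lam : kˣ} (hlam : IsPrimitiveRoot lam (autOrder σ))
include hlam

theorem exists_pow_val_of_pow_eq_one {u : kˣ} (hu : u ^ autOrder σ = 1) :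
    ∃ a : ZMod (autOrder σ), u = lam ^ a.val := by
  have h1 : (u : k) ^ autOrder σ = 1 := by rw [← Units.val_pow_eq_pow_val, hu, Units.val_one]
  obtain ⟨i, hi, hiu⟩ := ((IsPrimitiveRoot.coe_units_iff).2 hlam).eq_pow_of_pow_eq_one h1
  refine ⟨i, Units.ext ?_⟩
  rw [pow_val_natCast hlam.pow_eq_one, Units.val_pow_eq_pow_val, hiu]

/-- The orbit-dependent integer ℓ is a disguise: it is κ m - κ s reduced modulo the length of the
orbit of m, and σ^ℓ m depends on nothing more. With s = p + q and m = q the exponent becomes -κ p.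
-/
theorem isGammaPair_iff_isTwistedPair [Finite M] {τ : Equiv.Perm M}
    {κ : M → ZMod (autOrder σ)} {α : AddChar M kˣ} (hα : ∀ m, α m = (lam ^ (κ m).val)⁻¹) :
    IsGammaPair lam σ τ α ↔ IsTwistedPair σ τ κ := by
  have h1 := hlam.pow_eq_one
  have hinj := pow_val_injective hlam.eq_orderOf.symm
  have hadd : ∀ p q, κ (p + q) = κ p + κ q := fun p q => by
    have h2 := α.map_add_eq_mul p q
    rw [hα, hα, hα, ← mul_inv, inv_inj, ← pow_val_add h1] at h2
    exact hinj h2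
  have hcomp : (∀ m, α (σ m) = α m) ↔ ∀ m, κ (σ m) = κ m := by
    simp only [hα, inv_inj, hinj.eq_iff]
  have hpow : ∀ m, α m ^ autOrder σ = 1 := fun m => by
    rw [hα, inv_pow, ← pow_mul, mul_comm, pow_mul, h1, one_pow, inv_one]
  have hex : ∀ s m, (∃ l : ℕ, l < Function.minimalPeriod σ m ∧
      (α s / α m) ^ (autOrder σ / Function.minimalPeriod σ m) =
        (lam ^ (autOrder σ / Function.minimalPeriod σ m)) ^ l ∧
      τ (s - m) = τ s - τ (σ^[l] m)) ↔
      τ (s - m) = τ s - τ (σ^[(κ m - κ s).val] m) := fun s m => by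
    have hd := minimalPeriod_dvd_autOrder σ m
    set d := Function.minimalPeriod σ m with hd_def
    have hd0 : 0 < d := Function.minimalPeriod_pos_of_mem_periodicPts
      (Function.Injective.mem_periodicPts σ.injective m)
    have hdiv : α s / α m = lam ^ (κ m - κ s).val := by
      rw [div_eq_mul_inv, hα, hα, inv_inv, sub_eq_neg_add, pow_val_add h1, pow_val_neg h1]
    -- Both sides are powers of λ with exponents divisible by N/d. Equality modulo N becomes, after
    -- division by N/d, a congruence modulo d.
    have hl : ∀ l : ℕ, (α s / α m) ^ (autOrder σ / d) = (lam ^ (autOrder σ / d)) ^ l ↔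
        (κ m - κ s).val ≡ l [MOD d] := fun l => by
      rw [hdiv, ← pow_mul, ← pow_mul, mul_comm (autOrder σ / d), pow_eq_pow_iff_modEq,
        ← hlam.eq_orderOf, mul_div_modEq_iff (NeZero.ne _) hd]
    constructor
    · rintro ⟨l, -, h2, h3⟩
      rw [h3, iterate_eq_of_modEq σ ((hl l).1 h2)]
    · intro h2
      refine ⟨(κ m - κ s).val % d, Nat.mod_lt _ hd0, (hl _).2 (Nat.mod_modEq _ _).symm, ?_⟩
      rw [h2, iterate_eq_of_modEq σ (Nat.mod_modEq _ _)]
  constructor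
  · intro h
    refine ⟨h.perm_comm, hcomp.1 h.char_comp, hadd, fun p q => ?_⟩
    have h2 := (hex (p + q) q).1 (h.map_sub _ _)
    rw [add_sub_cancel_right, hadd, sub_add_cancel_right, h.comm_pow] at h2
    rw [h2, sub_add_cancel]
  · intro h
    refine ⟨h.perm_comm, hcomp.2 h.comp, hpow, fun s m => (hex s m).2 ?_⟩
    have h2 := h.perm_add (s - m) m
    have h3 : κ m - κ s = -κ (s - m) := by
      rw [← sub_add_cancel s m, hadd, add_sub_cancel_right]; abel
    rw [h3, h.comm_iterate, eq_sub_iff_add_eq, ← h2, sub_add_cancel]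

theorem IsGammaPair.exists_isTwistedPair [Finite M] {τ : Equiv.Perm M} {α : AddChar M kˣ}
    (h : IsGammaPair lam σ τ α) :
    ∃ κ : M → ZMod (autOrder σ), IsTwistedPair σ τ κ ∧ ∀ m, α m = (lam ^ (κ m).val)⁻¹ := by
  have h1 : ∀ m, ∃ a : ZMod (autOrder σ), (α m)⁻¹ = lam ^ a.val := fun m =>
    exists_pow_val_of_pow_eq_one hlam (by rw [inv_pow, h.char_pow, inv_one])
  choose κ hκ using h1
  have hα : ∀ m, α m = (lam ^ (κ m).val)⁻¹ := fun m => by rw [← hκ, inv_inv]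
  exact ⟨κ, (isGammaPair_iff_isTwistedPair hlam hα).1 h, hα⟩

theorem IsTwistedPair.exists_isGammaPair [Finite M] {τ : Equiv.Perm M}
    {κ : M → ZMod (autOrder σ)} (h : IsTwistedPair σ τ κ) :
    ∃ α : AddChar M kˣ, IsGammaPair lam σ τ α ∧ ∀ m, α m = (lam ^ (κ m).val)⁻¹ := by
  let α : AddChar M kˣ :=
    { toFun := fun m => (lam ^ (κ m).val)⁻¹
      map_zero_eq_one' := by
        have h0 : κ 0 = 0 := by simpa using h.add 0 0
        simp [h0]
      map_add_eq_mul' := fun p q => by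
        rw [h.add, pow_val_add hlam.pow_eq_one, mul_inv] }
  exact ⟨α, (isGammaPair_iff_isTwistedPair hlam (α := α) fun _ => rfl).2 h, fun _ => rfl⟩

/-- This makes F ↦ τ injective although membership in Γ only asks for some α. -/
theorem IsGammaPair.char_unique [Finite M] {τ : Equiv.Perm M} {α α' : AddChar M kˣ}
    (h : IsGammaPair lam σ τ α) (h' : IsGammaPair lam σ τ α') : α = α' := by
  obtain ⟨κ, hκ, hα⟩ := h.exists_isTwistedPair hlam
  obtain ⟨κ', hκ', hα'⟩ := h'.exists_isTwistedPair hlam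
  ext m
  rw [hα, hα', hκ.unique hκ']

end TwistedPermutations

/-! ### Self-duality of ℤ/N, and idempotent bases of group algebras. -/

/-- The bicharacter `(c, i) ↦ λ^(-c i)` of `ℤ/N`. -/
def rootPairing {k : Type*} [Field k] (N : ℕ) (lam : kˣ) (c i : ZMod N) : k :=
  ((lam⁻¹ ^ (c * i).val : kˣ) : k)

theorem isSymmBichar_rootPairing {k : Type*} [Field k] {N : ℕ} [NeZero N] {lam : kˣ}
    (hlam : IsPrimitiveRoot lam N) : IsSymmBichar (rootPairing N lam) where
  card_ne := by
    -- A primitive N-th root of unity in a field forces N to be nonzero there.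
    have := (IsPrimitiveRoot.coe_units_iff.2 hlam).neZero'
    rw [Nat.card_zmod]
    exact this.ne
  symm a b := by rw [rootPairing, mul_comm, rootPairing]
  zero_left r := by simp [rootPairing]
  add_left a b r := by
    rw [rootPairing, add_mul, pow_val_add hlam.inv.pow_eq_one, Units.val_mul, rootPairing,
      rootPairing]
  nondeg a ha := ⟨1, fun h1 => ha <| by
    rw [rootPairing, mul_one, Units.val_eq_one] at h1
    exact pow_val_injective hlam.inv.eq_orderOf.symm (by simpa using h1)⟩

theorem exists_mulEquiv_zmod {X : Type*} [Group X] {N : ℕ} [NeZero N] {x : X}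
    (hx : orderOf x = N) (hsurj : ∀ g : X, ∃ i : ℕ, g = x ^ i) :
    ∃ φ : Multiplicative (ZMod N) ≃* X, ∀ i, φ (Multiplicative.ofAdd i) = x ^ i.val := by
  have h1 : x ^ N = 1 := by rw [← hx, pow_orderOf_eq_one]
  let f : Multiplicative (ZMod N) →* X :=
    { toFun := fun i => x ^ (Multiplicative.toAdd i).val
      map_one' := by simp
      map_mul' := fun a b => pow_val_add h1 _ _ }
  refine ⟨MulEquiv.ofBijective f ⟨fun a b h => ?_, fun g => ?_⟩, fun i => rfl⟩
  · exact Multiplicative.toAdd.injective (pow_val_injective hx h)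
  · obtain ⟨i, rfl⟩ := hsurj g
    exact ⟨Multiplicative.ofAdd (i : ZMod N), pow_val_natCast h1 i⟩

section DualBasis

open Module

variable {k M X : Type*} [Field k] [AddCommGroup M] [Fintype M] [Group X]
  (φ : Multiplicative M ≃* X) {χ : M → M → k} (h : IsSymmBichar χ)

open Classical in
/-- The idempotents `dualIdem φ χ m` form a basis of the group algebra. -/
noncomputable def dualBasis : Basis M k (MonoidAlgebra k X) :=
  Basis.mk (v := dualIdem φ χ)
    (linearIndependent_of_orthogonal (IsSymmBichar.dualIdem_mul φ h)
      (IsSymmBichar.dualIdem_ne_zero φ h))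
    (by
      rintro f -
      induction f using MonoidAlgebra.induction_linear with
      | zero => exact zero_mem _
      | add f g hf hg => exact add_mem hf hg
      | single g a =>
        obtain ⟨r, rfl⟩ := φ.surjective g
        have h1 := IsSymmBichar.single_eq_sum φ h (Multiplicative.toAdd r)
        have h2 : MonoidAlgebra.single (φ r) a = a • MonoidAlgebra.single (φ r) (1 : k) := by simp
        rw [h2]
        refine Submodule.smul_mem _ _ ?_
        rw [ofAdd_toAdd] at h1
        rw [h1]
        exact sum_mem fun m _ => Submodule.smul_mem _ _ (Submodule.subset_span ⟨m, rfl⟩))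

@[simp]
theorem dualBasis_apply (m : M) : dualBasis φ h m = dualIdem φ χ m := by
  simp [dualBasis]

include h in
theorem dualIdem_injective : Function.Injective (dualIdem φ χ) := fun a b hab =>
  (dualBasis φ h).injective (by simpa using hab)

end DualBasis

/-! ### The biproduct as the function algebra of a semidirect product. -/

namespace BiproductDatum

open Module

variable {k 𝒢 G M : Type*} [Field k] [Group 𝒢] [Group G] [AddCommGroup M] [Fintype M]
  (D : BiproductDatum k 𝒢 G)

/-- For a trivial action the smash product is the tensor product of algebras, so products of
idempotents of the factors are idempotents of the biproduct. -/
theorem of_mul_of (hact : ∀ g, D.act g = 1) (b c : MonoidAlgebra k 𝒢) (f g : MonoidAlgebra k G) :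
    D.of (b ⊗ₜ f) * D.of (c ⊗ₜ g) = D.of ((b * c) ⊗ₜ (f * g)) := by
  induction f using MonoidAlgebra.induction_linear with
  | zero => simp
  | add f f' hf hf' => simp only [TensorProduct.tmul_add, map_add, add_mul, hf, hf']
  | single x r =>
  induction g using MonoidAlgebra.induction_linear with
  | zero => simp
  | add f f' hf hf' => simp only [TensorProduct.tmul_add, map_add, mul_add, hf, hf']
  | single y r' =>
    have h1 := D.el_mul_el b c x y
    rw [hact, ← map_one D.act, linEnd_act_one] at h1
    have h2 : ∀ (b : MonoidAlgebra k 𝒢) (x : G) (r : k),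
        D.of (b ⊗ₜ MonoidAlgebra.single x r) = r • D.el b x := fun b x r => by
      rw [el, ← map_smul, ← TensorProduct.tmul_smul]; simp
    rw [MonoidAlgebra.single_mul_single, h2, h2, h2, smul_mul_smul_comm, h1]

section Coproduct

variable (φ : Multiplicative M ≃* 𝒢) {χ : M → M → k} (hχ : IsSymmBichar χ) {σ : M ≃+ M}
  [NeZero (autOrder σ)]
  (hσ : ∀ m, linExt k D.θ (dualIdem φ χ m) = dualIdem φ χ (σ m))
  {lam : kˣ} (hlam : IsPrimitiveRoot lam (autOrder σ)) (hU : lam ∈ eigenvalueGroup k D.θ)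
  (φN : Multiplicative (ZMod (autOrder σ)) ≃* G)
  (hφN : ∀ i, φN (Multiplicative.ofAdd i) = D.gl ⟨lam, hU⟩ ^ i.val)

include hσ hlam hφN in
theorem coaction_dualIdem (s : M) : D.coaction (dualIdem φ χ s) =
    ∑ j, dualIdem φN (rootPairing _ lam) j ⊗ₜ[k] dualIdem φ χ (σ^[j.val] s) := by
  have hr := isSymmBichar_rootPairing hlam
  have hc : Nat.card G = Nat.card (ZMod (autOrder σ)) :=
    (Nat.card_congr (Multiplicative.ofAdd.trans φN.toEquiv)).symm
  -- The component of e_s in the λ^i-eigenspace: the average of λ^(-ij) e_{σ^j s} over j. Its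
  -- coaction is 𝛌^i ⊗ w_i, and summing over i collects the powers of 𝛌 into the idempotents E_j.
  let w : ZMod (autOrder σ) → MonoidAlgebra k 𝒢 := fun i =>
    ∑ j, (rootPairing (autOrder σ) lam i j / (Nat.card G : k)) • dualIdem φ χ (σ^[j.val] s)
  have hw : ∀ i, D.coaction (w i) = MonoidAlgebra.single (φN (Multiplicative.ofAdd i)) 1 ⊗ₜ w i := by
    intro i
    have h1 : D.IsEig (⟨lam, hU⟩ ^ i.val) (w i) := by
      have h2 : ∀ j : ZMod (autOrder σ), linExt k D.θ (dualIdem φ χ (σ^[j.val] s)) =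
          dualIdem φ χ (σ^[(1 + j).val] s) := fun j => by
        rw [hσ, iterate_val_add, iterate_val_one]
      have h3 : ((lam ^ i.val : kˣ) : k) = rootPairing (autOrder σ) lam i (-1) := by
        rw [rootPairing, mul_neg, mul_one, pow_val_neg hlam.inv.pow_eq_one, inv_pow, inv_inv]
      simp only [IsEig, w, linEnd, AlgEquiv.toLinearMap_apply, map_sum, map_smul, h2,
        Finset.smul_sum, smul_smul, SubmonoidClass.mk_pow, h3]
      refine Fintype.sum_equiv (Equiv.addLeft 1) _ _ fun j => ?_
      rw [Equiv.coe_addLeft, ← mul_div_assoc, ← hr.add_right, neg_add_cancel_left]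
    rw [h1.coaction, hφN]
    congr 2
    rw [gl, map_pow, Subgroup.coe_pow]
  have hsum : dualIdem φ χ s = ∑ i, w i := by
    simp only [w]
    rw [Finset.sum_comm]
    simp only [← Finset.sum_smul, hr.symm _ (_ : ZMod (autOrder σ)), hc, hr.sum_right_div]
    simp
  conv_lhs => rw [hsum]
  simp only [map_sum, hw]
  simp only [w, TensorProduct.tmul_sum]
  rw [Finset.sum_comm]
  refine Finset.sum_congr rfl fun j _ => ?_
  rw [IsSymmBichar.dualIdem_eq φN, TensorProduct.sum_tmul]
  refine Finset.sum_congr rfl fun i _ => ?_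
  rw [hr.symm i j, TensorProduct.tmul_smul, TensorProduct.smul_tmul', hc]

include hχ hσ hlam hφN in
-- The coproduct formula is linear in f, so it may be checked on group elements; it is needed for f
-- = E_c.
theorem comul_of_dualIdem_tmul (m : M) (f : MonoidAlgebra k G) :
    Coalgebra.comul (R := k) (D.of (dualIdem φ χ m ⊗ₜ f)) =
    ∑ s, ∑ j, TensorProduct.map
      (D.of.toLinearMap ∘ₗ TensorProduct.mk k _ _ (dualIdem φ χ (m - s)) ∘ₗ
        LinearMap.mulLeft k (dualIdem φN (rootPairing _ lam) j))
      (D.of.toLinearMap ∘ₗ TensorProduct.mk k _ _ (dualIdem φ χ (σ^[j.val] s)))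
      (Coalgebra.comul (R := k) f) := by
  induction f using MonoidAlgebra.induction_linear with
  | zero => simp
  | add f g hf hg =>
    simp only [TensorProduct.tmul_add, map_add, hf, hg, Finset.sum_add_distrib]
  | single g r =>
    have h1 : MonoidAlgebra.single g r = r • MonoidAlgebra.single g (1 : k) := by simp
    have h2 : Coalgebra.comul (R := k) (MonoidAlgebra.single g (1 : k)) =
        MonoidAlgebra.single g (1 : k) ⊗ₜ MonoidAlgebra.single g (1 : k) := by simp
    rw [h1, TensorProduct.tmul_smul]
    simp only [map_smul, ← Finset.smul_sum]
    congr 1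
    have h3 := D.comul_el (dualIdem φ χ m) g
    rw [el] at h3
    rw [h3, IsSymmBichar.comul_dualIdem φ hχ, map_sum, h2]
    refine Finset.sum_congr rfl fun s _ => ?_
    simp [split, D.coaction_dualIdem φ hσ hlam hU φN hφN, TensorProduct.tmul_sum]

/-- The basis `e_m × E_c` of the biproduct. -/
noncomputable def biproductBasis : Basis (M × ZMod (autOrder σ)) k D.Biproduct :=
  ((dualBasis φ hχ).tensorProduct (dualBasis φN (isSymmBichar_rootPairing hlam))).map D.of

theorem biproductBasis_apply (p : M × ZMod (autOrder σ)) :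
    D.biproductBasis φ hχ hlam φN p =
      D.of (dualIdem φ χ p.1 ⊗ₜ dualIdem φN (rootPairing _ lam) p.2) := by
  simp [biproductBasis, Basis.tensorProduct_apply']

open Classical in
theorem biproductBasis_mul (hact : ∀ g, D.act g = 1) (p q : M × ZMod (autOrder σ)) :
    D.biproductBasis φ hχ hlam φN p * D.biproductBasis φ hχ hlam φN q =
      if p = q then D.biproductBasis φ hχ hlam φN p else 0 := by
  simp only [biproductBasis_apply, D.of_mul_of hact, IsSymmBichar.dualIdem_mul φ hχ,
    IsSymmBichar.dualIdem_mul φN (isSymmBichar_rootPairing hlam), Prod.ext_iff]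
  split_ifs <;> simp_all

theorem sum_biproductBasis : ∑ p, D.biproductBasis φ hχ hlam φN p = 1 := by
  simp only [biproductBasis_apply, Fintype.sum_prod_type, ← map_sum, ← TensorProduct.tmul_sum,
    ← TensorProduct.sum_tmul, IsSymmBichar.sum_dualIdem φ hχ,
    IsSymmBichar.sum_dualIdem φN (isSymmBichar_rootPairing hlam)]
  rfl

include hσ hφN in
theorem comul_biproductBasis (p : M × ZMod (autOrder σ)) :
    Coalgebra.comul (R := k) (D.biproductBasis φ hχ hlam φN p) =
      ∑ q, D.biproductBasis φ hχ hlam φN q ⊗ₜ[k]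
        D.biproductBasis φ hχ hlam φN (semiLd σ q p) := by
  classical
  obtain ⟨m, c⟩ := p
  have hr := isSymmBichar_rootPairing hlam
  rw [biproductBasis_apply, D.comul_of_dualIdem_tmul φ hχ hσ hlam hU φN hφN,
    IsSymmBichar.comul_dualIdem φN hr, Fintype.sum_prod_type]
  rw [← Equiv.sum_comp (Equiv.subLeft m)]
  refine Finset.sum_congr rfl fun q _ => ?_
  simp only [map_sum, TensorProduct.map_tmul, LinearMap.comp_apply, LinearMap.mulLeft_apply,
    TensorProduct.mk_apply, IsSymmBichar.dualIdem_mul φN hr, LinearEquiv.coe_coe,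
    Equiv.subLeft_apply, sub_sub_cancel]
  refine Finset.sum_congr rfl fun a _ => ?_
  -- The first tensor factor contains E_a times the left part E_{c-b} of Δ E_c, which vanishes
  -- unless b = c - a.
  rw [Finset.sum_eq_single (c - a)]
  · simp [biproductBasis_apply, semiLd]
  · intro b _ hb
    rw [if_neg]
    · simp
    · rintro rfl
      simp at hb
  · simp

open Classical in
theorem proj_biproductBasis (m : M) (c : ZMod (autOrder σ)) :
    D.proj (D.biproductBasis φ hχ hlam φN (m, c)) =
      if m = 0 then dualIdem φN (rootPairing _ lam) c else 0 := by
  simp [biproductBasis_apply, proj, IsSymmBichar.counit_dualIdem φ hχ]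

include hφN in
theorem el_dualIdem_pow (s : M) (l : ℕ) :
    D.el (dualIdem φ χ s) (D.gl ⟨lam, hU⟩ ^ l) =
      ∑ c, rootPairing (autOrder σ) lam c (-l) • D.biproductBasis φ hχ hlam φN (s, c) := by
  have h1 : D.gl ⟨lam, hU⟩ ^ l = φN (Multiplicative.ofAdd (l : ZMod (autOrder σ))) := by
    rw [hφN, pow_val_natCast]
    have : (⟨lam, hU⟩ : eigenvalueGroup k D.θ) ^ autOrder σ = 1 :=
      Subtype.ext hlam.pow_eq_one
    rw [gl, ← Subgroup.coe_pow, ← map_pow, this, map_one, Subgroup.coe_one]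
  rw [el, h1, IsSymmBichar.single_eq_sum φN (isSymmBichar_rootPairing hlam)]
  simp only [TensorProduct.tmul_sum, TensorProduct.tmul_smul, map_sum, map_smul,
    biproductBasis_apply]

omit [NeZero (autOrder σ)] in
include hφN in
theorem ext_el_dualIdem {W : Type*} [AddCommGroup W] [Module k W] (hχ : IsSymmBichar χ)
    {f f' : D.Biproduct →ₗ[k] W}
    (h : ∀ s (l : ℕ), f (D.el (dualIdem φ χ s) (D.gl ⟨lam, hU⟩ ^ l)) =
      f' (D.el (dualIdem φ χ s) (D.gl ⟨lam, hU⟩ ^ l))) : f = f' := by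
  refine D.ext_el fun x g => ?_
  obtain ⟨i, rfl⟩ := φN.surjective g
  rw [← ofAdd_toAdd i, hφN]
  generalize (Multiplicative.toAdd i).val = l
  rw [← (dualBasis φ hχ).sum_repr (MonoidAlgebra.single x 1)]
  simp only [el, TensorProduct.sum_tmul, map_sum, ← TensorProduct.smul_tmul', map_smul,
    dualBasis_apply]
  exact Finset.sum_congr rfl fun s _ => congrArg _ (h s l)

include hφN in
-- Since 𝛌^l = ∑ λ^(cl) E_c, shifting c by κ s multiplies the sum by λ^(-l κ s) = α(s)^l. This is
-- where the sign in α = λ^(-κ) comes from.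
theorem map_el_dualIdem_pow {F : D.Biproduct →ₗ[k] D.Biproduct} {τ : M → M}
    {κ : M → ZMod (autOrder σ)} (hF : ∀ m c, F (D.biproductBasis φ hχ hlam φN (m, c)) =
      D.biproductBasis φ hχ hlam φN (τ m, κ m + c)) {α : M → kˣ}
    (hα : ∀ m, α m = (lam ^ (κ m).val)⁻¹) (s : M) (l : ℕ) :
    F (D.el (dualIdem φ χ s) (D.gl ⟨lam, hU⟩ ^ l)) =
      ((α s : kˣ) : k) ^ l • D.el (dualIdem φ χ (τ s)) (D.gl ⟨lam, hU⟩ ^ l) := by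
  have hr := isSymmBichar_rootPairing hlam
  have h1 : ((α s : kˣ) : k) ^ l = rootPairing (autOrder σ) lam (κ s) l := by
    rw [hα, rootPairing, ← Units.val_pow_eq_pow_val, ← inv_pow, ← pow_mul]
    congr 1
    rw [← pow_val_natCast hlam.inv.pow_eq_one ((κ s).val * l)]
    simp
  simp only [D.el_dualIdem_pow φ hχ hlam hU φN hφN, map_sum, map_smul, hF, Finset.smul_sum,
    smul_smul]
  refine Fintype.sum_equiv (Equiv.addLeft (κ s)) _ _ fun c => ?_
  rw [Equiv.coe_addLeft, h1, hr.add_left, ← mul_assoc, ← hr.add_right, add_neg_cancel,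
    hr.zero_right, one_mul]

include hσ hlam hφN in
theorem exists_gammaPair_of_mem_autHopf (hact : ∀ g, D.act g = 1) (hχ : IsSymmBichar χ)
    {F : D.Biproduct ≃ₐ[k] D.Biproduct} (hF : F ∈ D.autHopf) :
    ∃ (τ : Equiv.Perm M) (α : AddChar M kˣ), IsGammaPair lam σ τ α ∧
      ∀ s (l : ℕ), F (D.el (dualIdem φ χ s) (D.gl ⟨lam, hU⟩ ^ l)) =
        ((α s : kˣ) : k) ^ l • D.el (dualIdem φ χ (τ s)) (D.gl ⟨lam, hU⟩ ^ l) := by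
  classical
  obtain ⟨⟨-, hcomul⟩, hproj⟩ := hF
  obtain ⟨P, hP⟩ := exists_perm_of_algEquiv (D.biproductBasis φ hχ hlam φN)
    (D.biproductBasis_mul φ hχ hlam φN hact) (D.sum_biproductBasis φ hχ hlam φN) F
  have hld := (map_comp_comul_iff (D.biproductBasis φ hχ hlam φN) (semiLd σ)
    (D.comul_biproductBasis φ hχ hσ hlam hU φN hφN) F.toLinearMap P hP).1 hcomul
  -- The projection kills e_m × E_c for m ≠ 0 and sends e_0 × E_c to E_c ≠ 0, so invariance under F
  -- pins down P (0, c).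
  have hfix : ∀ c, P (0, c) = (0, c) := fun c => by
    have h1 := LinearMap.congr_fun hproj (D.biproductBasis φ hχ hlam φN (0, c))
    rw [LinearMap.comp_apply, AlgEquiv.toLinearMap_apply, hP, ← Prod.mk.eta (p := P (0, c)),
      proj_biproductBasis, proj_biproductBasis, if_pos rfl] at h1
    have hr := isSymmBichar_rootPairing hlam
    split_ifs at h1 with h2
    · exact Prod.ext h2 (dualIdem_injective φN hr h1)
    · exact absurd h1.symm (IsSymmBichar.dualIdem_ne_zero φN hr c)
  obtain ⟨τ, κ, hτ, hPτ⟩ := exists_isTwistedPair hld hfix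
  obtain ⟨α, hα, hακ⟩ := hτ.exists_isGammaPair hlam
  exact ⟨τ, α, hα, D.map_el_dualIdem_pow φ hχ hlam hU φN hφN (F := F.toLinearMap)
    (fun m c => by rw [AlgEquiv.toLinearMap_apply, hP, hPτ]) hακ⟩

include hσ hφN in
theorem exists_mem_autHopf_of_gammaPair (hact : ∀ g, D.act g = 1) (hχ : IsSymmBichar χ)
    (hlam : IsPrimitiveRoot lam (autOrder σ)) {τ : Equiv.Perm M}
    {α : AddChar M kˣ} (h : IsGammaPair lam σ τ α) :
    ∃ F ∈ D.autHopf, ∀ s (l : ℕ), F (D.el (dualIdem φ χ s) (D.gl ⟨lam, hU⟩ ^ l)) =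
      ((α s : kˣ) : k) ^ l • D.el (dualIdem φ χ (τ s)) (D.gl ⟨lam, hU⟩ ^ l) := by
  classical
  obtain ⟨κ, hτ, hακ⟩ := h.exists_isTwistedPair hlam
  obtain ⟨P, hld, hfix, hPτ⟩ := hτ.exists_perm
  obtain ⟨F, hF⟩ := exists_algEquiv_of_perm (D.biproductBasis φ hχ hlam φN)
    (D.biproductBasis_mul φ hχ hlam φN hact) (D.sum_biproductBasis φ hχ hlam φN) P
  have hκ : κ 0 = 0 := by simpa using hτ.add 0 0
  have hz : ∀ m, τ m = 0 ↔ m = 0 := fun m => by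
    rw [← τ.injective.eq_iff (a := m) (b := 0), hτ.map_zero]
  -- The counit is evaluation at the neutral element (0, 0), which P fixes.
  have hcounit : ∀ p, Coalgebra.counit (R := k) (D.biproductBasis φ hχ hlam φN p) =
      if p = 0 then 1 else 0 := fun p => by
    rw [biproductBasis_apply, counit_of]
    simp only [smashCounit, LinearMap.comp_apply, TensorProduct.map_tmul, LinearMap.mul'_apply,
      IsSymmBichar.counit_dualIdem φ hχ,
      IsSymmBichar.counit_dualIdem φN (isSymmBichar_rootPairing hlam), Prod.ext_iff]
    split_ifs <;> simp_all
  refine ⟨F, ⟨⟨?_, ?_⟩, ?_⟩, D.map_el_dualIdem_pow φ hχ hlam hU φN hφN (F := F.toLinearMap)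
    (fun m c => by rw [AlgEquiv.toLinearMap_apply, hF, hPτ]) hακ⟩
  · refine (D.biproductBasis φ hχ hlam φN).ext fun p => ?_
    have h0 : P p = 0 ↔ p = 0 := by
      rw [← P.injective.eq_iff (a := p) (b := 0)]
      exact Eq.congr_right (hfix 0).symm
    rw [LinearMap.comp_apply, AlgEquiv.toLinearMap_apply, hF, hcounit, hcounit]
    simp only [h0]
  · exact (map_comp_comul_iff (D.biproductBasis φ hχ hlam φN) (semiLd σ)
      (D.comul_biproductBasis φ hχ hσ hlam hU φN hφN) F.toLinearMap P hF).2 hld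
  · refine (D.biproductBasis φ hχ hlam φN).ext fun p => ?_
    obtain ⟨m, c⟩ := p
    rw [LinearMap.comp_apply, AlgEquiv.toLinearMap_apply, hF, hPτ, proj_biproductBasis,
      proj_biproductBasis]
    by_cases hm : m = 0
    · subst hm
      rw [if_pos hτ.map_zero, if_pos rfl, hκ, zero_add]
    · rw [if_neg hm, if_neg (mt (hz m).1 hm)]

end Coproduct

end BiproductDatum

/-! ### Eigenvalues of the linear extension and N-th roots of unity. -/

section LinearExtension

variable {k 𝒢 : Type*} [Field k]

theorem linEnd_mul_apply [Group 𝒢] (a b : MulAut 𝒢) (x : MonoidAlgebra k 𝒢) :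
    linEnd k (a * b) x = linEnd k a (linEnd k b x) := by
  have : linEnd k (a * b) = linEnd k a ∘ₗ linEnd k b := by
    ext; simp [linExt]
  exact LinearMap.congr_fun this x

theorem eq_one_of_linEnd_eq_id [Group 𝒢] {a : MulAut 𝒢} (h : linEnd k a = LinearMap.id) :
    a = 1 := by
  refine MulEquiv.ext fun x => ?_
  have h1 := LinearMap.congr_fun h (MonoidAlgebra.single x 1)
  rw [BiproductDatum.linEnd_single] at h1
  exact MonoidAlgebra.of_injective (R := k) h1

theorem linEnd_one_eq_id [Group 𝒢] : linEnd k (1 : MulAut 𝒢) = LinearMap.id := by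
  ext; simp [linExt]

theorem linEnd_pow_apply_of_eigen [Group 𝒢] {a : MulAut 𝒢} {μ : k} {x : MonoidAlgebra k 𝒢}
    (h : linEnd k a x = μ • x) (j : ℕ) : linEnd k (a ^ j) x = μ ^ j • x := by
  induction j with
  | zero => rw [pow_zero, linEnd_one_eq_id, pow_zero, one_smul, LinearMap.id_apply]
  | succ j ih => rw [pow_succ, linEnd_mul_apply, h, map_smul, ih, smul_smul, pow_succ']

theorem pow_orderOf_eq_one_of_mem_eigenvalueGroup [Group 𝒢] {θ : MulAut 𝒢} {u : kˣ}
    (hu : u ∈ eigenvalueGroup k θ) : u ^ orderOf θ = 1 := by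
  -- The N-th roots of unity form a subgroup, so it is enough to treat eigenvalues, where θ^N = 1 is
  -- applied to an eigenvector.
  have hle : eigenvalueGroup k θ ≤ (powMonoidHom (orderOf θ) : kˣ →* kˣ).ker := by
    refine (Subgroup.closure_le _).2 fun v hv => ?_
    obtain ⟨x, hx⟩ := Module.End.HasEigenvalue.exists_hasEigenvector hv
    have h1 := linEnd_pow_apply_of_eigen hx.apply_eq_smul (orderOf θ)
    rw [pow_orderOf_eq_one, linEnd_one_eq_id, LinearMap.id_apply] at h1
    have h2 : (v : k) ^ orderOf θ = 1 :=
      smul_left_injective k hx.2 (h1.symm.trans (one_smul k x).symm)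
    exact Units.ext (by simpa using h2)
  exact hle hu

end LinearExtension

namespace BiproductDatum

variable {k 𝒢 G : Type*} [Field k] [Group 𝒢] [Group G] (D : BiproductDatum k 𝒢 G)

/-- U consists of N-th roots of unity, hence is finite and cyclic. If ζ generates U, then θ to the
power `orderOf ζ` fixes every eigenvector, hence is 1 by diagonalizability. So N divides the order
of ζ. -/
theorem exists_primitiveRoot_mem_eigenvalueGroup [Finite 𝒢] :
    ∃ ζ ∈ eigenvalueGroup k D.θ, IsPrimitiveRoot ζ (orderOf D.θ) := by
  have : NeZero (orderOf D.θ) := ⟨(orderOf_pos D.θ).ne'⟩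
  have hle : eigenvalueGroup k D.θ ≤ rootsOfUnity (orderOf D.θ) k := fun u hu =>
    (mem_rootsOfUnity _ _).2 (pow_orderOf_eq_one_of_mem_eigenvalueGroup hu)
  have : Finite (eigenvalueGroup k D.θ) :=
    Finite.of_injective _ (Subgroup.inclusion_injective hle)
  obtain ⟨ζ, hζ⟩ := IsCyclic.exists_generator (α := eigenvalueGroup k D.θ)
  have hθ : D.θ ^ orderOf ζ = 1 := by
    refine eq_one_of_linEnd_eq_id (k := k) (D.ext_eig fun u b hb => ?_)
    obtain ⟨i, rfl⟩ := Subgroup.mem_zpowers_iff.1 (hζ u)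
    have h1 : (ζ ^ i) ^ orderOf ζ = 1 := by
      rw [← zpow_natCast, ← zpow_mul, mul_comm, zpow_mul, zpow_natCast, pow_orderOf_eq_one,
        one_zpow]
    have h2 := congrArg (fun v : eigenvalueGroup k D.θ => ((v : kˣ) : k)) h1
    simp only [Subgroup.coe_pow, Units.val_pow_eq_pow_val, Subgroup.coe_one, Units.val_one] at h2
    rw [linEnd_pow_apply_of_eigen hb, h2, one_smul, LinearMap.id_apply]
  refine ⟨ζ, ζ.2, ?_⟩
  have h3 : orderOf (ζ : kˣ) = orderOf D.θ := by
    refine Nat.dvd_antisymm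
      (orderOf_dvd_of_pow_eq_one (pow_orderOf_eq_one_of_mem_eigenvalueGroup ζ.2)) ?_
    rw [Subgroup.orderOf_coe]
    exact orderOf_dvd_of_pow_eq_one hθ
  rw [← h3]
  exact IsPrimitiveRoot.orderOf _

theorem mem_eigenvalueGroup_of_isPrimitiveRoot [Finite 𝒢] {lam : kˣ}
    (hlam : IsPrimitiveRoot lam (orderOf D.θ)) : lam ∈ eigenvalueGroup k D.θ := by
  have : NeZero (orderOf D.θ) := ⟨(orderOf_pos D.θ).ne'⟩
  obtain ⟨ζ, hζU, hζ⟩ := D.exists_primitiveRoot_mem_eigenvalueGroup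
  have h1 : (lam : k) ^ orderOf D.θ = 1 := by
    rw [← Units.val_pow_eq_pow_val, hlam.pow_eq_one, Units.val_one]
  obtain ⟨i, -, hi⟩ := (IsPrimitiveRoot.coe_units_iff.2 hζ).eq_pow_of_pow_eq_one h1
  have h2 : lam = ζ ^ i := Units.ext (by rw [Units.val_pow_eq_pow_val, hi])
  rw [h2]
  exact pow_mem hζU i

end BiproductDatum

/-! ### The pairing given by ω, and the automorphism σ dual to θ. -/

section FormalPow

variable {k 𝒢 : Type*} [Field k] [CommGroup 𝒢] {t : ℕ} {n : Fin t → ℕ} [∀ i, NeZero (n i)]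
  (φ : Multiplicative (AddVersion n) ≃* 𝒢) {ω : k} (hω : IsPrimitiveRoot ω (Nat.card 𝒢))
include φ hω

theorem isSymmBichar_formalPow :
    IsSymmBichar fun m r : AddVersion n => formalPow ω (m * r) := by
  have hcard : Nat.card (AddVersion n) = ∏ i, n i := by simp
  have hc : Nat.card 𝒢 = Nat.card (AddVersion n) :=
    (Nat.card_congr (Multiplicative.ofAdd.trans φ.toEquiv)).symm
  rw [hc] at hω
  have hpos : 0 < ∏ i, n i := Finset.prod_pos fun i _ => Nat.pos_of_ne_zero (NeZero.ne _)
  have hj : ∀ j, IsPrimitiveRoot (ω ^ ((∏ i, n i) / n j)) (n j) := fun j =>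
    hω.pow (hcard ▸ hpos)
      (hcard.trans (Nat.div_mul_cancel (Finset.dvd_prod_of_mem n (Finset.mem_univ j))).symm)
  refine ⟨?_, fun a b => ?_, fun r => ?_, fun a b r => ?_, fun a ha => ?_⟩
  · have : NeZero (Nat.card (AddVersion n)) := ⟨by rw [hcard]; exact hpos.ne'⟩
    exact hω.neZero'.ne
  · simp only [mul_comm]
  · simp [formalPow]
  · simp only [formalPow, add_mul, Pi.add_apply, pow_val_add (hj _).pow_eq_one,
      Finset.prod_mul_distrib]
  -- Nondegeneracy is tested on a unit vector: there the pairing is a power of a primitive n_j-th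
  -- root of unity with exponent strictly between 0 and n_j.
  · obtain ⟨j, hja⟩ := Function.ne_iff.1 ha
    refine ⟨Pi.single j 1, ?_⟩
    have h1 : formalPow ω (a * Pi.single j 1) = (ω ^ ((∏ i, n i) / n j)) ^ (a j).val := by
      rw [formalPow, Finset.prod_eq_single j]
      · simp
      · intro i _ hi
        simp [hi]
      · simp
    rw [h1]
    exact (hj j).pow_ne_one_of_pos_of_lt (by simpa using hja) (ZMod.val_lt _)

end FormalPow

section Permutation

variable {k 𝒢 M : Type*} [Field k] [Group 𝒢] [AddCommGroup M] [Fintype M]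
  (φ : Multiplicative M ≃* 𝒢) {χ : M → M → k} (hχ : IsSymmBichar χ)
include hχ

/-- Composing the character χ(m, ·) with the inverse of θ gives a character again, which by
self-duality is χ(σ m, ·) for a unique σ m. -/
theorem exists_addEquiv_linExt_dualIdem (θ : MulAut 𝒢) :
    ∃ σ : M ≃+ M, ∀ m, linExt k θ (dualIdem φ χ m) = dualIdem φ χ (σ m) := by
  let t : M ≃+ M := MulEquiv.toAdditive ((φ.trans θ).trans φ.symm)
  have ht : ∀ r, θ (φ (Multiplicative.ofAdd r)) = φ (Multiplicative.ofAdd (t r)) := fun r =>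
    (φ.apply_symm_apply _).symm
  have hex : ∀ m, ∃ a, ∀ r, χ m (t.symm r) = χ a r := fun m =>
    hχ.exists_eq (fun r => χ m (t.symm r)) (by simp [hχ.zero_right])
      (fun r s => by simp only [map_add, hχ.add_right])
  choose s hs using hex
  have hadd : ∀ a b, s (a + b) = s a + s b := fun a b => hχ.injective <| funext fun r => by
    rw [hχ.add_left, ← hs, ← hs, ← hs, hχ.add_left]
  have hinj : Function.Injective s := fun a b hab => hχ.injective <| funext fun r => by
    have h1 := hs a (t r)
    rw [hab, ← hs, AddEquiv.symm_apply_apply] at h1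
    exact h1
  refine ⟨AddEquiv.ofBijective (AddMonoidHom.mk' s hadd)
    ⟨hinj, Finite.surjective_of_injective hinj⟩, fun m => ?_⟩
  simp only [dualIdem, map_sum, BiproductDatum.linExt_single, ht]
  refine Fintype.sum_equiv t.toEquiv _ _ fun r => ?_
  have h1 := hs m (t r)
  rw [AddEquiv.symm_apply_apply] at h1
  rw [h1]
  rfl

variable {θ : MulAut 𝒢} {σ : M ≃+ M}
  (hσ : ∀ m, linExt k θ (dualIdem φ χ m) = dualIdem φ χ (σ m))
include hσ

theorem autOrder_eq_orderOf : autOrder σ = orderOf θ := by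
  have h1 : ∀ (j : ℕ) m, linEnd k (θ ^ j) (dualIdem φ χ m) = dualIdem φ χ (σ^[j] m) := by
    intro j
    induction j with
    | zero => intro m; rw [pow_zero, linEnd_one_eq_id]; rfl
    | succ j ih =>
      intro m
      rw [pow_succ, linEnd_mul_apply]
      have h2 : linEnd k θ (dualIdem φ χ m) = dualIdem φ χ (σ m) := hσ m
      rw [h2, ih, Function.iterate_succ_apply]
  refine orderOf_eq_orderOf_iff.2 fun j => ⟨fun h => ?_, fun h => ?_⟩
  · refine eq_one_of_linEnd_eq_id (k := k) ((dualBasis φ hχ).ext fun m => ?_)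
    have h2 : σ^[j] = id := by
      have h3 := Equiv.Perm.iterate_eq_pow (σ.toEquiv : Equiv.Perm M) j
      rw [h] at h3
      exact h3
    rw [dualBasis_apply, h1, h2]
    rfl
  · refine Equiv.ext fun m => dualIdem_injective φ hχ ?_
    rw [← Equiv.Perm.iterate_eq_pow]
    refine (h1 j m).symm.trans ?_
    rw [h, linEnd_one_eq_id]
    rfl

end Permutation

/-! ### Assembly of the isomorphism onto Γ and the bijection onto the pairs. -/

namespace BiproductDatum

variable {k 𝒢 G M : Type*} [Field k] [Group 𝒢] [Group G] [AddCommGroup M] [Fintype M]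
  (D : BiproductDatum k 𝒢 G)

theorem projB_el (b : MonoidAlgebra k 𝒢) (g : G) : D.projB (D.el b g) = b := by
  simp [projB]

theorem isCoalgMap_iff_exists_addEquiv (φ : Multiplicative M ≃* 𝒢) {χ : M → M → k}
    (hχ : IsSymmBichar χ) {f : MonoidAlgebra k 𝒢 →ₗ[k] MonoidAlgebra k 𝒢} {τ : Equiv.Perm M}
    (hf : ∀ m, f (dualIdem φ χ m) = dualIdem φ χ (τ m)) :
    IsCoalgMap f ↔ ∃ β : M ≃+ M, β.toEquiv = τ := by
  classical
  have hx : ∀ p, Coalgebra.comul (R := k) (dualBasis φ hχ p) =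
      ∑ q, dualBasis φ hχ q ⊗ₜ[k] dualBasis φ hχ (p - q) := fun p => by
    simp only [dualBasis_apply, IsSymmBichar.comul_dualIdem φ hχ]
    exact Fintype.sum_equiv (Equiv.subLeft p) _ _ fun s => by simp
  have hiff := map_comp_comul_iff (dualBasis φ hχ) (fun q p => p - q) hx f τ (by simpa using hf)
  constructor
  · rintro ⟨-, h⟩
    have h1 := hiff.1 h
    refine ⟨AddEquiv.mk' τ fun a b => ?_, rfl⟩
    have h2 := h1 b (a + b)
    rw [add_sub_cancel_right] at h2
    rw [h2, sub_add_cancel]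
  · rintro ⟨β, rfl⟩
    refine ⟨(dualBasis φ hχ).ext fun m => ?_, hiff.2 fun q p => map_sub β p q⟩
    have h1 : β m = 0 ↔ m = 0 := map_eq_zero_iff β β.injective
    rw [LinearMap.comp_apply, dualBasis_apply, hf, IsSymmBichar.counit_dualIdem φ hχ,
      IsSymmBichar.counit_dualIdem φ hχ]
    exact if_congr h1 rfl rfl

/-- The two hypotheses on D are what restricting the group to 𝐔 achieves: a trivial action, and a
group filled by the elements 𝛍. -/
theorem exists_autHopf_equiv (hact : ∀ g, D.act g = 1) (hgl : Function.Surjective D.gl)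
    (φ : Multiplicative M ≃* 𝒢) {χ : M → M → k} (hχ : IsSymmBichar χ) {σ : M ≃+ M}
    (hσ : ∀ m, linExt k D.θ (dualIdem φ χ m) = dualIdem φ χ (σ m))
    {lam : kˣ} (hlam : IsPrimitiveRoot lam (autOrder σ)) (hU : lam ∈ eigenvalueGroup k D.θ) :
    ∃ (Φ : D.autHopf ≃* Gamma lam σ hlam)
      (Ψ : D.autHopf ≃ {p : Equiv.Perm M × AddChar M kˣ // IsGammaPair lam σ p.1 p.2}),
      (∀ F m, D.leftFactor F (dualIdem φ χ m) = dualIdem φ χ ((Φ F : Equiv.Perm M) m)) ∧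
      (∀ F, IsCoalgMap (D.leftFactor F) ↔
        ∃ β : M ≃+ M, β.toEquiv = (Φ F : Equiv.Perm M)) ∧
      (∀ F, (Ψ F).1.1 = (Φ F : Equiv.Perm M)) ∧
      (∀ (F : D.autHopf) (s : M) (l : ℕ), (F : D.Biproduct ≃ₐ[k] D.Biproduct)
          (D.el (dualIdem φ χ s) (D.gl ⟨lam, hU⟩ ^ l)) =
        (((Ψ F).1.2 s : kˣ) : k) ^ l •
          D.el (dualIdem φ χ ((Ψ F).1.1 s)) (D.gl ⟨lam, hU⟩ ^ l)) := by
  have : NeZero (autOrder σ) := ⟨autOrder_ne_zero σ⟩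
  have hord : orderOf (D.gl ⟨lam, hU⟩) = autOrder σ := by
    rw [Subgroup.orderOf_coe, MulEquiv.orderOf_eq, hlam.eq_orderOf, Subgroup.orderOf_mk]
  -- Every element of U is an N-th root of unity, hence a power of λ.
  have hgen : ∀ g : G, ∃ i : ℕ, g = D.gl ⟨lam, hU⟩ ^ i := fun g => by
    obtain ⟨u, rfl⟩ := hgl g
    have h1 := pow_orderOf_eq_one_of_mem_eigenvalueGroup u.2
    rw [← autOrder_eq_orderOf φ hχ hσ] at h1
    obtain ⟨a, ha⟩ := exists_pow_val_of_pow_eq_one hlam h1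
    refine ⟨a.val, ?_⟩
    have h2 : u = ⟨lam, hU⟩ ^ a.val := Subtype.ext ha
    rw [h2, gl, map_pow, Subgroup.coe_pow]
  obtain ⟨φN, hφN⟩ := exists_mulEquiv_zmod hord hgen
  choose τ α hpair hF using fun F : D.autHopf =>
    D.exists_gammaPair_of_mem_autHopf φ hσ hlam hU φN hφN hact hχ F.2
  have hone : ∀ (F : D.autHopf) m, (F : D.Biproduct ≃ₐ[k] D.Biproduct) (D.el (dualIdem φ χ m) 1) =
      D.el (dualIdem φ χ (τ F m)) 1 := fun F m => by simpa using hF F m 0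
  -- The case l = 0, where the character disappears, already determines τ. This gives
  -- multiplicativity of F ↦ τ without tracking α.
  have hτ : ∀ (F : D.autHopf) (τ' : Equiv.Perm M),
      (∀ m, (F : D.Biproduct ≃ₐ[k] D.Biproduct) (D.el (dualIdem φ χ m) 1) =
        D.el (dualIdem φ χ (τ' m)) 1) → τ F = τ' := fun F τ' h => Equiv.ext fun m => by
    have h1 := congrArg D.projB ((hone F m).symm.trans (h m))
    rw [projB_el, projB_el] at h1
    exact dualIdem_injective φ hχ h1
  have hinj : Function.Injective τ := fun F F' h => by
    have hα : α F = α F' := (hpair F).char_unique hlam (h ▸ hpair F')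
    have h1 : (F : D.Biproduct ≃ₐ[k] D.Biproduct).toLinearMap =
        (F' : D.Biproduct ≃ₐ[k] D.Biproduct).toLinearMap :=
      D.ext_el_dualIdem φ hU φN hφN hχ fun s l => by
        simp only [AlgEquiv.toLinearMap_apply, hF, h, hα]
    exact Subtype.ext (AlgEquiv.toLinearMap_injective h1)
  have hsurj : ∀ (τ' : Equiv.Perm M) (α' : AddChar M kˣ), IsGammaPair lam σ τ' α' →
      ∃ F, τ F = τ' ∧ α F = α' := fun τ' α' h => by
    obtain ⟨F, hFm, hF'⟩ := D.exists_mem_autHopf_of_gammaPair φ hσ hU φN hφN hact hχ hlam h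
    have h1 : τ ⟨F, hFm⟩ = τ' := hτ _ _ fun m => by simpa using hF' m 0
    exact ⟨⟨F, hFm⟩, h1, (hpair _).char_unique hlam (h1.symm ▸ h)⟩
  let Φ : D.autHopf →* Gamma lam σ hlam := MonoidHom.mk' (fun F => ⟨τ F, α F, hpair F⟩)
    fun F F' => Subtype.ext <| hτ _ _ fun m => by
      change (F : D.Biproduct ≃ₐ[k] D.Biproduct) ((F' : D.Biproduct ≃ₐ[k] D.Biproduct) _) = _
      rw [hone, hone]
      rfl
  have hleft : ∀ F m, D.leftFactor F (dualIdem φ χ m) = dualIdem φ χ (τ F m) := fun F m => by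
    have h1 := congrArg D.projB (hone F m)
    rw [projB_el] at h1
    exact h1
  refine ⟨MulEquiv.ofBijective Φ ⟨fun F F' h => hinj (congrArg Subtype.val h), ?_⟩,
    Equiv.ofBijective (fun F => ⟨(τ F, α F), hpair F⟩)
      ⟨fun F F' h => hinj (congrArg (fun p => p.1.1) h), ?_⟩, hleft,
    fun F => isCoalgMap_iff_exists_addEquiv φ hχ (hleft F), fun _ => rfl, hF⟩
  · rintro ⟨τ', α', h⟩
    obtain ⟨F, h1, -⟩ := hsurj τ' α' h
    exact ⟨F, Subtype.ext h1⟩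
  · rintro ⟨⟨τ', α'⟩, h⟩
    obtain ⟨F, h1, h2⟩ := hsurj τ' α' h
    exact ⟨F, Subtype.ext (Prod.ext h1 h2)⟩

end BiproductDatum

theorem mainTheorem4 {k 𝒢 G : Type*} [Field k] [CommGroup 𝒢] [Finite 𝒢] [Group G]
    (D : BiproductDatum k 𝒢 G) :
    (∃ lam : kˣ, IsPrimitiveRoot lam (orderOf D.θ)) ∧
    ∀ ω : k, IsPrimitiveRoot ω (Nat.card 𝒢) →
    ∀ (t : ℕ) (n : Fin t → ℕ) [∀ i, NeZero (n i)] (φ : Multiplicative (AddVersion n) ≃* 𝒢),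
    ∃ σ : AddVersion n ≃+ AddVersion n,
      (∀ m, linExt k D.θ (idem φ ω m) = idem φ ω (σ m)) ∧
      (∀ σ' : AddVersion n ≃+ AddVersion n,
        (∀ m, linExt k D.θ (idem φ ω m) = idem φ ω (σ' m)) → σ' = σ) ∧
      autOrder σ = orderOf D.θ ∧
      ∀ (lam : kˣ) (hlam : IsPrimitiveRoot lam (autOrder σ)),
      ∃ (hU : lam ∈ eigenvalueGroup k D.θ)
        (Φ : D.restrict.autHopf ≃* Gamma lam σ hlam)
        (Ψ : D.restrict.autHopf ≃
          {p : Equiv.Perm (AddVersion n) × AddChar (AddVersion n) kˣ //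
            IsGammaPair lam σ p.1 p.2}),
        (∀ F m, D.restrict.leftFactor F (idem φ ω m) =
          idem φ ω ((Φ F : Equiv.Perm (AddVersion n)) m)) ∧
        (∀ F, IsCoalgMap (D.restrict.leftFactor F) ↔
          ∃ β : AddVersion n ≃+ AddVersion n,
            β.toEquiv = (Φ F : Equiv.Perm (AddVersion n))) ∧
        (∀ F, (Ψ F).1.1 = (Φ F : Equiv.Perm (AddVersion n))) ∧
        (∀ (F : D.restrict.autHopf) (s : AddVersion n) (l : ℕ),
          (F : D.restrict.Biproduct ≃ₐ[k] D.restrict.Biproduct)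
              (D.restrict.el (idem φ ω s) (D.bold ⟨lam, hU⟩ ^ l)) =
            (((Ψ F).1.2 s : kˣ) : k) ^ l •
              D.restrict.el (idem φ ω ((Ψ F).1.1 s)) (D.bold ⟨lam, hU⟩ ^ l)) := by

  obtain ⟨ζ, -, hζ⟩ := D.exists_primitiveRoot_mem_eigenvalueGroup
  refine ⟨⟨ζ, hζ⟩, fun ω hω t n _ φ => ?_⟩
  have hχ := isSymmBichar_formalPow φ hω
  -- From here `idem φ ω` is identified by unfolding with `dualIdem` for the pairing (m, r) ↦
  -- ω^(mr).
  obtain ⟨σ, hσ⟩ := exists_addEquiv_linExt_dualIdem φ hχ D.θ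
  have hord := autOrder_eq_orderOf φ hχ hσ
  refine ⟨σ, hσ, fun σ' hσ' => AddEquiv.ext fun m =>
    dualIdem_injective φ hχ ((hσ' m).symm.trans (hσ m)), hord, fun lam hlam => ?_⟩
  have hU := D.mem_eigenvalueGroup_of_isPrimitiveRoot (hord ▸ hlam)
  refine ⟨hU, D.restrict.exists_autHopf_equiv (fun g => D.bU_le_ker g.2) (fun g => ?_)
    φ hχ hσ hlam hU⟩
  obtain ⟨u, hu⟩ := D.bold.surjective g
  exact ⟨u, hu⟩
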